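/- **Conventions.** A $d$-dimensional complex $X$ on $[n]$ is a nonempty pure simplicial complex all of whose singletons are faces; $X(i)$ is the set of faces with $i$ vertices, the maximal faces are those in $X(d)$, and $\mu_i$ is the distribution on $X(i)$ of a uniform $i$-subset of a uniform $D\in X(d)$. $X$ is a $\gamma$ one-sided local spectral expander if for every face $I$ (including $\emptyset$) with $|I|\le d-2$ the weighted graph underlying the link of $I$ has second eigenvalue at most $\gamma$. For $F:X(k)\to\Sigma^k$ (where $F[A]$ is read as a labelling of the vertices of $A$), the $(k,\sqrt k)$-direct product test picks $D\in X(d)$ uniformly, a uniform $B\subseteq D$ of size $\sqrt k$, independent uniform $k$-sets $A,A'$ with $B\subseteq A,A'\subseteq D$, and accepts if $F[A]|_B=F[A']|_B$. It has soundness $\delta$ (with polynomial $\mathrm{poly}(t)=c\,t^r$) if for every finite $\Sigma$ and every $F$ that passes with probability at least $\delta$ there is $f:X(1)\to\Sigma$ with $\Pr_{A\sim\mu_k}[\Delta(F[A],f|_A)\le\delta]\ge \mathrm{poly}(\delta)$, where $\Delta$ is relative Hamming distance. A generalized 2-CSP $\Psi$ over $(X(1),X(2))$ (edges weighted by $\mu_2$)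 has a finite alphabet $\Sigma$, whose symbols are coded by bit strings of some fixed length, alphabets $\Sigma(u)\subseteq\Sigma$ and constraints $\Psi_e\subseteq\Sigma\times\Sigma$. The value $\mathsf{val}(\Psi)$ is the maximum over $f:X(1)\to\Sigma$ of the weight of the edges $e=(u,v)$ with $f(u)\in\Sigma(u)$, $f(v)\in\Sigma(v)$ and $(f(u),f(v))\in\Psi_e$. The decision complexity of $\Psi$ is the maximum over edges $(u,v)$ of the sum of the circuit complexities of membership in $\Psi_{(u,v)}$, $\Sigma(u)$ and $\Sigma(v)$. A generalized Label Cover instance $\Phi$ over the weighted inclusion graph $(X(k),X(\sqrt k))$ (pick $A\sim\mu_k$ and a uniform $B\subseteq A$ of size $\sqrt k$) with left alphabet $\Sigma^k$ and right alphabet $\Sigma^{\sqrt k}$ has sets $\Sigma_L(A)\subseteq\Sigma^k$ and maps $\phi_{(A,B)}:\Sigma_L(A)\to\Sigma^{\sqrt k}$; $\mathsf{val}(\Phi)$ is the maximum over $F:X(k)\to\Sigma^k$ and $H:X(\sqrt k)\to\Sigma^{\sqrt k}$ of the probability that $F(A)\in\Sigma_L(A)$ and $\phi_{(A,B)}(F(A))=H(B)$.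 **Lemma 7.2.** Fix the polynomial $\mathrm{poly}(t)=c\,t^r$ ($c>0$, $r\in\mathbb N$) in the definition of soundness. For every $\delta>0$ and all sufficiently large perfect squares $k$ there are $\gamma>0$ and a polynomial time procedure (whose polynomial may depend on $k$) such that the following holds. Let $X$ be a $d$-dimensional $\gamma$ one-sided local spectral expander with $d>k$ for which the $(k,\sqrt k)$-direct product test has soundness $\delta^2$. Given $X$ (by its $d$-faces and edges) and a generalized 2-CSP $\Psi$ over $(X(1),X(2))$ with alphabets $\Sigma,\{\Sigma(u)\}$ and decision complexity $D$ (by circuits for the sets $\Sigma(u)$ and $\Psi_e$), the procedure produces a generalized Label Cover instance $\Phi$ over the weighted inclusion graph $(X(k),X(\sqrt k))$ with left alphabet $\Sigma^k$ and right alphabet $\Sigma^{\sqrt k}$ (by a list in which each edge has frequency equal to its weight, and circuits for the sets $\Sigma_L(A)$) such that: 1. for every edge $(A,B)$ and every $\sigma\in\Sigma_L(A)$, $\phi_{(A,B)}(\sigma)=\sigma|_B$; 2. for every $A\in X(k)$, the circuit complexity of membership in $\Sigma_L(A)$ is $O(k^2D)$, and the circuits produced have size $O(k^2D')$, where $D'$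 is the maximum over the edges $(u,v)$ of the total size of the circuits given for $\Psi_{(u,v)},\Sigma(u),\Sigma(v)$; the implied constants are absolute; 3. if $\mathsf{val}(\Psi)=1$ then $\mathsf{val}(\Phi)=1$; 4. if $\mathsf{val}(\Phi)\ge\delta$ then $\mathsf{val}(\Psi)\ge 1-4\delta$; and if $\mathsf{val}(\Psi)\le 1-4\delta$ then $\mathsf{val}(\Phi)\le\delta$. -/

import Mathlib

open scoped BigOperators

/-! ### Pure simplicial complexes, their face distributions, local spectral expansion -/

/-- A (nonempty, pure) `d`-dimensional simplicial complex with vertex set `[n]`, in the convention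
in which an `i`-face is a face with `i` vertices: every face lies in a face of size `d`
(so that no face has more than `d` vertices). Every `v ∈ [n]` is a vertex. -/
structure PureComplex (n d : ℕ) extends AbstractSimplicialComplex (Fin n) where
  nonempty : faces.Nonempty
  pure : ∀ A ∈ faces, ∃ D ∈ faces, A ⊆ D ∧ D.card = d

namespace PureComplex

variable {n d : ℕ} (X : PureComplex n d)

/-- `X(i)`, the set of faces with exactly `i` vertices (for `i ≥ 1`). -/
def Face (i : ℕ) : Type := {A : Finset (Fin n) // A ∈ X.faces ∧ A.card = i}

noncomputable instance (i : ℕ) : Fintype (X.Face i) :=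
  @Fintype.ofFinite _ (inferInstanceAs (Finite {A : Finset (Fin n) // A ∈ X.faces ∧ A.card = i}))

instance (i : ℕ) : DecidableEq (X.Face i) :=
  inferInstanceAs (DecidableEq {A : Finset (Fin n) // A ∈ X.faces ∧ A.card = i})

/-- The vertices `a₁ < a₂ < ⋯ < aᵢ` of an `i`-face `A`. An element of `Σ^i` is read as a labelling
of `A` by giving its `t`-th coordinate to `aₜ`. -/
def vert {i : ℕ} (A : X.Face i) : Fin i ↪o Fin n := A.1.orderEmbOfFin A.2.2

/-- The number of `d`-faces that contain `A`. -/
noncomputable def topDegree (A : Finset (Fin n)) : ℕ :=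
  (Finset.univ.filter fun D : X.Face d => A ⊆ D.1).card

/-- The probability `μᵢ(A)` of a set `A` of size `i`: pick `D ∈ X(d)` uniformly and then a uniform
subset of `D` of size `i`. -/
noncomputable def mu (i : ℕ) (A : Finset (Fin n)) : ℝ :=
  (X.topDegree A : ℝ) / ((Fintype.card (X.Face d) : ℝ) * (d.choose i : ℝ))

/-- The weight of the edge `{u, v}` in the graph underlying the link of `I`, up to normalization
(the distribution of edges of the link is proportional to `μ_{|I|+2}(I ∪ {u, v})`). -/
noncomputable def linkWeight (I : Finset (Fin n)) (u v : Fin n) : ℝ :=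
  if u ≠ v ∧ u ∉ I ∧ v ∉ I then (X.topDegree (I ∪ {u, v}) : ℝ) else 0

end PureComplex

/-- The second largest eigenvalue of the normalized adjacency operator
`(M g)(u) = ∑ v, w u v * g v / deg u`, `deg u = ∑ v, w u v`, of the weighted graph with symmetric
weights `w` is at most `γ`: on the functions orthogonal to the constants in `L²(deg)` the
quadratic form of `M` is at most `γ` times the squared norm. -/
def SecondEigenvalueLE {V : Type} [Fintype V] (w : V → V → ℝ) (γ : ℝ) : Prop :=
  ∀ g : V → ℝ, ∑ u, (∑ v, w u v) * g u = 0 →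
    ∑ u, ∑ v, w u v * g u * g v ≤ γ * ∑ u, (∑ v, w u v) * g u ^ 2

/-- `X` is a `γ` one-sided local spectral expander: the graphs underlying the links of all faces
of size at most `d - 2`, the empty face included, have second eigenvalue at most `γ`. -/
def PureComplex.IsLocalSpectralExpander {n d : ℕ} (X : PureComplex n d) (γ : ℝ) : Prop :=
  ∀ I : Finset (Fin n), (I = ∅ ∨ I ∈ X.faces) → I.card + 2 ≤ d →
    SecondEigenvalueLE (X.linkWeight I) γ

/-! ### The direct product test -/

namespace PureComplex

variable {n d : ℕ} (X : PureComplex n d)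

/-- The `k`-faces `A` with `B ⊆ A ⊆ D`. -/
noncomputable def between (k : ℕ) (B : Finset (Fin n)) (D : X.Face d) : Finset (X.Face k) :=
  Finset.univ.filter fun A => B ⊆ A.1 ∧ A.1 ⊆ D.1

/-- `F[A]|_B = F[A']|_B`, for `B ⊆ A, A'`. -/
def Agree {k : ℕ} {Sig : Type} (F : X.Face k → Fin k → Sig) (B : Finset (Fin n))
    (A A' : X.Face k) : Prop :=
  ∀ i i' : Fin k, X.vert A i ∈ B → X.vert A i = X.vert A' i' → F A i = F A' i'

open Classical in
/-- The probability that `F` passes the `(k, s)`-direct product test: pick `D ∈ X(d)`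
uniformly, then `B ⊆ D` of size `s` uniformly, then independent uniform `k`-faces `A, A'` with
`B ⊆ A, A' ⊆ D`, and check that `F[A]|_B = F[A']|_B`. -/
noncomputable def passProb {k : ℕ} (s : ℕ) {Sig : Type} (F : X.Face k → Fin k → Sig) : ℝ :=
  Finset.expect Finset.univ fun D : X.Face d =>
    Finset.expect (D.1.powersetCard s) fun B =>
      Finset.expect (X.between k B D) fun A =>
        Finset.expect (X.between k B D) fun A' =>
          if X.Agree F B A A' then (1 : ℝ) else 0

open Classical in
/-- The probability over `A ∼ μ_k` that the relative Hamming distance of `F[A]` and `f|_A` is at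
most `δ`. -/
noncomputable def agreementProb {k : ℕ} {Sig : Type} (F : X.Face k → Fin k → Sig)
    (f : Fin n → Sig) (δ : ℝ) : ℝ :=
  ∑ A : X.Face k,
    if (hammingDist (F A) (fun i => f (X.vert A i)) : ℝ) / k ≤ δ then X.mu k A.1 else 0

/-- The `(k, s)`-direct product test on `X` has soundness `δ` with agreement probability `η`:
for every finite alphabet, every `F : X(k) → Σ^k` that passes the test with probability at least
`δ` satisfies `Pr_A [Δ(F[A], f|_A) ≤ δ] ≥ η` for some `f : X(1) → Σ`. -/
def DPTestSound (k s : ℕ) (δ η : ℝ) : Prop :=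
  ∀ (Sig : Type) [Finite Sig] (F : X.Face k → Fin k → Sig), δ ≤ X.passProb s F →
    ∃ f : Fin n → Sig, η ≤ X.agreementProb F f δ

end PureComplex

/-! ### Boolean circuits -/

/-- A wire of a circuit whose input is a sequence of `a` symbols of `b` bits each: an input bit,
or the output of the `t`-th gate. -/
inductive Wire (a b : ℕ)
  | input (i : Fin a) (j : Fin b)
  | gate (t : ℕ)

/-- A gate of fan-in two over the full binary basis. -/
structure Gate (a b : ℕ) where
  op : Bool → Bool → Bool
  left : Wire a b
  right : Wire a b

/-- A Boolean circuit: its gates in topological order, and its output wire. -/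
structure Circuit (a b : ℕ) where
  gates : List (Gate a b)
  out : Wire a b

/-- The bit on a wire, given the input `x` and the values of the gates computed so far
(a gate that is not yet computed reads as `0`, so that circuits are acyclic). -/
def Wire.val {a b : ℕ} (x : Fin a → Fin b → Bool) (vals : List Bool) : Wire a b → Bool
  | .input i j => x i j
  | .gate t => vals.getD t false

namespace Circuit

variable {a b : ℕ}

/-- The values of all gates, computed one after the other. -/
def gateVals (gates : List (Gate a b)) (x : Fin a → Fin b → Bool) : List Bool :=
  gates.foldl (fun vals g => vals ++ [g.op (g.left.val x vals) (g.right.val x vals)]) []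

def eval (C : Circuit a b) (x : Fin a → Fin b → Bool) : Bool :=
  C.out.val x (gateVals C.gates x)

/-- The number of nodes that are not inputs: the gates and the output node. -/
def size (C : Circuit a b) : ℕ := C.gates.length + 1

/-- `C` decides membership in `S ⊆ Σ^a`, where the symbols of `Σ` are coded by `b` bits. -/
def Decides (C : Circuit a b) {Sig : Type} (enc : Sig ↪ (Fin b → Bool))
    (S : Set (Fin a → Sig)) : Prop :=
  ∀ σ : Fin a → Sig, C.eval (fun i => enc (σ i)) = true ↔ σ ∈ S

end Circuit

/-- The circuit complexity of checking membership in `S ⊆ Σ^a`. -/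
noncomputable def circuitComplexity {a b : ℕ} {Sig : Type} (enc : Sig ↪ (Fin b → Bool))
    (S : Set (Fin a → Sig)) : ℕ :=
  sInf {m | ∃ C : Circuit a b, C.Decides enc S ∧ C.size = m}

/-! ### Generalized 2-CSPs and generalized Label Cover -/

/-- A finite weighted graph with edges from `L` to `R`. It is used with `L` and `R` disjoint for a
bipartite graph, and with `L = R` for a graph in which each edge is listed in one orientation. -/
structure WeightedGraph (L R : Type) where
  edges : Finset (L × R)
  weight : L × R → ℝ

/-- A generalized 2-CSP on the weighted graph `G`, with alphabet `Sig`. -/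
structure GenCSP {V : Type} (G : WeightedGraph V V) (Sig : Type) where
  /-- the alphabets `Σ(u) ⊆ Σ` -/
  alphabet : V → Set Sig
  /-- the constraints `Ψ_e ⊆ Σ × Σ` (only those of edges matter) -/
  constraint : V × V → Set (Sig × Sig)

namespace GenCSP

variable {V : Type} {G : WeightedGraph V V} {Sig : Type} (Ψ : GenCSP G Sig)

/-- `f` satisfies the edge `e`: both labels are allowed and the constraint holds. -/
def Satisfies (f : V → Sig) (e : V × V) : Prop :=
  f e.1 ∈ Ψ.alphabet e.1 ∧ f e.2 ∈ Ψ.alphabet e.2 ∧ (f e.1, f e.2) ∈ Ψ.constraint e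

open Classical in
/-- The largest total weight of edges that an assignment satisfies. -/
noncomputable def value : ℝ :=
  ⨆ f : V → Sig, ∑ e ∈ G.edges, if Ψ.Satisfies f e then G.weight e else 0

/-- `Σ(u)` as a set of words of length one. -/
def vertexSet (u : V) : Set (Fin 1 → Sig) := {σ | σ 0 ∈ Ψ.alphabet u}

/-- `Ψ_e` as a set of words of length two. -/
def edgeSet (e : V × V) : Set (Fin 2 → Sig) := {σ | (σ 0, σ 1) ∈ Ψ.constraint e}

/-- The decision complexity: the maximum over the edges `e = (u, v)` of the sum of the circuit
complexities of checking membership in `Ψ_e`, in `Σ(u)` and in `Σ(v)`. -/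
noncomputable def decisionComplexity {b : ℕ} (enc : Sig ↪ (Fin b → Bool)) : ℕ :=
  G.edges.sup fun e => circuitComplexity enc (Ψ.edgeSet e) +
    circuitComplexity enc (Ψ.vertexSet e.1) + circuitComplexity enc (Ψ.vertexSet e.2)

end GenCSP

/-- A generalized Label Cover instance on the weighted bipartite graph `G`. -/
structure GenLabelCover {L R : Type} (G : WeightedGraph L R) (SigL SigR : Type) where
  /-- the left alphabets `Σ_L(U) ⊆ Σ_L` -/
  alphabet : L → Set SigL
  /-- the projection maps `φ_e : Σ_L(U) → Σ_R` (only those of edges matter) -/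
  proj : ∀ e : L × R, alphabet e.1 → SigR

namespace GenLabelCover

variable {L R : Type} {G : WeightedGraph L R} {SigL SigR : Type} (Φ : GenLabelCover G SigL SigR)

/-- The constraint `Φ_e = {(σ, φ_e(σ)) | σ ∈ Σ_L(U)}` of the edge `e = (U, V)`. -/
def constraint (e : L × R) : Set (SigL × SigR) :=
  Set.range fun σ : Φ.alphabet e.1 => ((σ : SigL), Φ.proj e σ)

open Classical in
/-- The largest total weight of edges whose constraints a pair of assignments satisfies. -/
noncomputable def value : ℝ :=
  ⨆ FH : (L → SigL) × (R → SigR),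
    ∑ e ∈ G.edges, if (FH.1 e.1, FH.2 e.2) ∈ Φ.constraint e then G.weight e else 0

end GenLabelCover

namespace PureComplex

variable {n d : ℕ} (X : PureComplex n d)

open Classical in
/-- The weighted graph `(X(1), X(2))`: an edge `{u, v}` with `u < v` is listed as `(u, v)` and has
weight `μ₂({u, v})`. -/
noncomputable def graph : WeightedGraph (Fin n) (Fin n) where
  edges := Finset.univ.filter fun e => e.1 < e.2 ∧ ({e.1, e.2} : Finset (Fin n)) ∈ X.faces
  weight e := X.mu 2 {e.1, e.2}

/-- The weighted inclusion graph between `X(k)` and `X(s)`: pick `A ∼ μ_k` and then `B ⊆ A` of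
size `s` uniformly. -/
noncomputable def inclusionGraph (k s : ℕ) : WeightedGraph (X.Face k) (X.Face s) where
  edges := Finset.univ.filter fun e => e.2.1 ⊆ e.1.1
  weight e := X.mu k e.1.1 / (k.choose s : ℝ)

/-- For each edge `(A, B)`, the projection map is `σ ↦ σ|_B`. -/
def RestrictionProjections {k s : ℕ} {Sig : Type}
    (Φ : GenLabelCover (X.inclusionGraph k s) (Fin k → Sig) (Fin s → Sig)) : Prop :=
  ∀ e ∈ (X.inclusionGraph k s).edges, ∀ σ : Φ.alphabet e.1, ∀ (i : Fin k) (j : Fin s),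
    X.vert e.1 i = X.vert e.2 j → Φ.proj e σ j = σ.1 i

end PureComplex

/-! ### Programs with a cost measure

Programs compute on binary trees. The cost of a run charges each executed instruction the sizes
of its complete input and output, so that a run of cost `t` takes time polynomial in `t` on a
Turing machine. Programs only have bounded loops and hence always halt; the iterations of a loop
are counted one by one. -/

/-- Binary trees, as a data type for lists, numbers etc. -/
inductive Dat
  | nil
  | cons (x y : Dat)
  deriving DecidableEq

namespace Dat

def size : Dat → ℕ
  | nil => 1
  | cons x y => x.size + y.size + 1

def fst : Dat → Dat
  | nil => nil
  | cons x _ => x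

def snd : Dat → Dat
  | nil => nil
  | cons _ y => y

/-- The elements of a tree that is read as a list. -/
def toList : Dat → List Dat
  | nil => []
  | cons x y => x :: y.toList

def ofList : List Dat → Dat
  | [] => nil
  | x :: l => cons x (ofList l)

def ofBool : Bool → Dat
  | false => nil
  | true => cons nil nil

/-- Numbers in unary. -/
def ofNat : ℕ → Dat
  | 0 => nil
  | m + 1 => cons nil (ofNat m)

end Dat

/-- Programs: the constant `nil`, the identity, the two projections, pairing, composition
(`comp p q` runs `q` first), a conditional, an equality test, and a loop over a list. -/
inductive Prog
  | nil
  | id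
  | fst
  | snd
  | pair (p q : Prog)
  | comp (p q : Prog)
  | ite (test p q : Prog)
  | eq
  | fold (body : Prog)

namespace Prog

/-- The output of a program. On input `(env, (acc, l))`, `fold body` replaces `acc` by
`body (env, (acc, y))` for the elements `y` of the list `l`, in order, and returns `acc`. -/
def eval : Prog → Dat → Dat
  | nil, _ => .nil
  | id, x => x
  | fst, x => x.fst
  | snd, x => x.snd
  | pair p q, x => .cons (p.eval x) (q.eval x)
  | comp p q, x => p.eval (q.eval x)
  | ite test p q, x => if test.eval x = .nil then q.eval x else p.eval x
  | eq, x => .ofBool (decide (x.fst = x.snd))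
  | fold body, x =>
      x.snd.snd.toList.foldl (fun acc y => body.eval (.cons x.fst (.cons acc y))) x.snd.fst

/-- The cost of all subprograms run by a program on an input. -/
def subcost : Prog → Dat → ℕ
  | pair p q, x =>
      (x.size + (p.eval x).size + p.subcost x) + (x.size + (q.eval x).size + q.subcost x)
  | comp p q, x =>
      (x.size + (q.eval x).size + q.subcost x) +
        ((q.eval x).size + (p.eval (q.eval x)).size + p.subcost (q.eval x))
  | ite test p q, x =>
      (x.size + (test.eval x).size + test.subcost x) +
        (if test.eval x = .nil then x.size + (q.eval x).size + q.subcost x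
          else x.size + (p.eval x).size + p.subcost x)
  | fold body, x =>
      (x.snd.snd.toList.foldl
        (fun (st : Dat × ℕ) y =>
          let z := Dat.cons x.fst (.cons st.1 y)
          (body.eval z, st.2 + (z.size + (body.eval z).size + body.subcost z)))
        (x.snd.fst, 0)).2
  | _, _ => 0

/-- The cost of a run: every program costs the sizes of its input and of its output, plus the
costs of the subprograms that it runs. -/
def cost (p : Prog) (x : Dat) : ℕ := x.size + (p.eval x).size + p.subcost x

end Prog

/-! ### Codes of instances -/

namespace PureComplex

/-- A face is coded by the increasing list of its vertices. -/
def faceDat {n d : ℕ} (X : PureComplex n d) {i : ℕ} (A : X.Face i) : Dat :=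
  .ofList (List.ofFn fun t => .ofNat (X.vert A t))

end PureComplex

def Wire.toDat {a b : ℕ} : Wire a b → Dat
  | .input i j => .cons .nil (.cons (.ofNat i) (.ofNat j))
  | .gate t => .cons (.ofBool true) (.ofNat t)

/-- A gate is coded by the truth table of its operation and its two wires. -/
def Gate.toDat {a b : ℕ} (g : Gate a b) : Dat :=
  .cons (.ofList [.ofBool (g.op false false), .ofBool (g.op false true),
    .ofBool (g.op true false), .ofBool (g.op true true)]) (.cons g.left.toDat g.right.toDat)

def Circuit.toDat {a b : ℕ} (C : Circuit a b) : Dat :=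
  .cons (.ofList (C.gates.map Gate.toDat)) C.out.toDat

/-- A description of a generalized 2-CSP over `(X(1), X(2))` whose symbols are coded by `b` bits:
lists of the `d`-faces and of the edges of `X`, and circuits for the alphabets of the vertices and
for the constraints of the edges. -/
structure CSPCode {n d : ℕ} (X : PureComplex n d) (b : ℕ) where
  tops : List (X.Face d)
  edges : List (Fin n × Fin n)
  vertexCircuit : Fin n → Circuit 1 b
  edgeCircuit : Fin n × Fin n → Circuit 2 b

namespace CSPCode

variable {n d : ℕ} {X : PureComplex n d} {b : ℕ}

structure Describes (code : CSPCode X b) {Sig : Type} (enc : Sig ↪ (Fin b → Bool))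
    (Ψ : GenCSP X.graph Sig) : Prop where
  tops_nodup : code.tops.Nodup
  mem_tops : ∀ D, D ∈ code.tops
  edges_nodup : code.edges.Nodup
  mem_edges : ∀ e, e ∈ code.edges ↔ e ∈ X.graph.edges
  vertex : ∀ u, (code.vertexCircuit u).Decides enc (Ψ.vertexSet u)
  edge : ∀ e ∈ X.graph.edges, (code.edgeCircuit e).Decides enc (Ψ.edgeSet e)

/-- The maximum over the edges of the sum of the sizes of the three circuits supplied for it. -/
noncomputable def circuitSize (code : CSPCode X b) : ℕ :=
  X.graph.edges.sup fun e =>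
    (code.edgeCircuit e).size + (code.vertexCircuit e.1).size + (code.vertexCircuit e.2).size

def toDat (code : CSPCode X b) : Dat :=
  .ofList [.ofNat b,
    .ofList (code.tops.map X.faceDat),
    .ofList ((List.finRange n).map fun u : Fin n => .cons (.ofNat (u : ℕ)) (code.vertexCircuit u).toDat),
    .ofList (code.edges.map fun e : Fin n × Fin n =>
      .cons (.cons (.ofNat (e.1 : ℕ)) (.ofNat (e.2 : ℕ))) (code.edgeCircuit e).toDat)]

end CSPCode

/-- A description of a generalized Label Cover instance over the weighted inclusion graph of `X(k)`
and `X(s)` with restriction maps as projections: a list of edges, in which an edge occurs with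
frequency equal to its weight, and circuits for the left alphabets. -/
structure LabelCoverCode {n d : ℕ} (X : PureComplex n d) (k s b : ℕ) where
  edges : List (X.Face k × X.Face s)
  left : List (X.Face k × Circuit k b)

namespace LabelCoverCode

variable {n d : ℕ} {X : PureComplex n d} {k s b : ℕ}

structure Describes (code : LabelCoverCode X k s b) {Sig : Type} (enc : Sig ↪ (Fin b → Bool))
    (Φ : GenLabelCover (X.inclusionGraph k s) (Fin k → Sig) (Fin s → Sig)) : Prop where
  mem_edges : ∀ e, e ∈ code.edges ↔ e ∈ (X.inclusionGraph k s).edges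
  weight : ∀ e ∈ (X.inclusionGraph k s).edges,
    (X.inclusionGraph k s).weight e = (code.edges.count e : ℝ) / (code.edges.length : ℝ)
  mem_left : ∀ A, ∃ C, (A, C) ∈ code.left
  left : ∀ A C, (A, C) ∈ code.left → C.Decides enc (Φ.alphabet A)
  proj : X.RestrictionProjections Φ

def toDat (code : LabelCoverCode X k s b) : Dat :=
  .ofList [.ofNat b,
    .ofList (code.edges.map fun e => .cons (X.faceDat e.1) (X.faceDat e.2)),
    .ofList (code.left.map fun e => .cons (X.faceDat e.1) e.2.toDat)]

end LabelCoverCode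

/-! The left labels of a `k`-face `A` are the labellings of `A` that satisfy every edge inside `A`,
and the projections are restrictions. Completeness is the restriction of a satisfying assignment. A
left alphabet is decided by a conjunction of at most `k²` edge checks together with the checks of
their endpoints, which gives the size bound `size_all_faceChecks_le`.

Soundness for `δ ≤ 1/4` goes by contradiction (`lt_value_of_le_value_labelCover`). Let `F`, `H`
satisfy weight at least `δ`. Let `F'` be `F` on the faces where `F A` is an allowed label, and give
every other face a constant word in a symbol of its own. Two faces whose constraints with `H(B)`
hold agree on `B`, so by Cauchy-Schwarz `F'` passes the test with probability at least `δ²`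
(`sq_le_passProb`). The test then supplies an `f` that is `δ²`-close to `F'` on faces of total mass
at least `η = c (δ²)^r`. These faces are of two kinds.

Faces with a private symbol: a vertex has only one symbol, so `f` is close to few of these words,
and the mass is at most `2/k` (`sum_mu_close_const_le`).

Faces with an allowed label: `f` violates at most `δ² k(k-1)` edges of such a face. If `val(Ψ) ≤
1-4δ`, then the mean number of violated edges in a random face is at least `2δ k(k-1)`, and
Chebyshev bounds the mass by `8/(δ²(k-1))` (`sum_mu_few_violations_le`). The variance bound
`sum_pairs_sq_sub_mean_le` uses the link estimate `sum_sq_sub_mean_le` at every vertex and at the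
empty face; expansion with `γ = 1/k` makes the correlations between vertices of a random face cost
no more than the diagonal terms.

For large `k` the two masses add up to less than `η`. For `δ > 1/4` nothing is to be shown, as `1-4δ
< 0 ≤ val(Ψ)`.

For fixed `k` the output is written by a fixed nest of loops over lists. The lemmas on `PolyTime`
give a polynomial cost for each list operation, and the lemmas ending in `_toDat` identify the
resulting tree with the code of the instance. -/

/-! ### Trees as lists -/

namespace Dat

@[simp] theorem fst_cons (x y : Dat) : (cons x y).fst = x := rfl

@[simp] theorem snd_cons (x y : Dat) : (cons x y).snd = y := rfl

@[simp] theorem toList_ofList (l : List Dat) : (ofList l).toList = l := by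
  induction l with
  | nil => rfl
  | cons a l ih => simp [ofList, toList, ih]

@[simp] theorem ofList_toList (x : Dat) : ofList x.toList = x := by
  induction x with
  | nil => rfl
  | cons a l _ ih => simp [ofList, toList, ih]

theorem size_fst_le (x : Dat) : x.fst.size ≤ x.size := by
  cases x <;> simp [size, fst]; omega

theorem size_snd_le (x : Dat) : x.snd.size ≤ x.size := by
  cases x <;> simp [size, snd]; omega

theorem size_le_of_mem {x y : Dat} (h : y ∈ x.toList) : y.size ≤ x.size := by
  induction x with
  | nil => simp [toList] at h
  | cons a l _ ih =>
    simp only [toList, List.mem_cons] at h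
    rcases h with rfl | h
    · simp [size]; omega
    · have := ih h
      simp [size]; omega

theorem length_toList_le (x : Dat) : x.toList.length ≤ x.size := by
  induction x with
  | nil => simp [toList]
  | cons a l _ ih => simp [toList, size]; omega

theorem size_ofList_append (l m : List Dat) :
    (ofList (l ++ m)).size + 1 = (ofList l).size + (ofList m).size := by
  induction l with
  | nil => simp [ofList, size]; omega
  | cons a l ih => simp [ofList, size]; omega

theorem ofNat_eq_ofList (m : ℕ) : ofNat m = ofList (List.replicate m nil) := by
  induction m with
  | zero => rfl
  | succ m ih => simp [ofNat, List.replicate_succ, ofList, ih]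

@[simp] theorem toList_ofNat (m : ℕ) : (ofNat m).toList = List.replicate m nil := by
  rw [ofNat_eq_ofList, toList_ofList]

theorem ofNat_injective : Function.Injective ofNat := fun a b h => by
  simpa using congrArg (fun x => x.toList.length) h

@[simp] theorem ofNat_inj {a b : ℕ} : ofNat a = ofNat b ↔ a = b := ofNat_injective.eq_iff

end Dat

theorem Polynomial.eval_nat_mono (p : Polynomial ℕ) {a b : ℕ} (h : a ≤ b) :
    p.eval a ≤ p.eval b := by
  simp only [Polynomial.eval_eq_sum, Polynomial.sum]
  exact Finset.sum_le_sum fun i _ => Nat.mul_le_mul_left _ (Nat.pow_le_pow_left h i)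

/-! ### Functions computed by programs of polynomial cost -/

/-- `f` is computed by a program whose cost is polynomial in the size of the input. -/
def PolyTime (f : Dat → Dat) : Prop :=
  ∃ (P : Prog) (p : Polynomial ℕ), ∀ x, P.eval x = f x ∧ P.cost x ≤ p.eval x.size

namespace PolyTime

open Polynomial

/-- The cost of a run charges for its output, so a cost bound is also a size bound. Compositions and
loops stay polynomial because of this. -/
theorem size_le {f : Dat → Dat} (hf : PolyTime f) :
    ∃ p : Polynomial ℕ, ∀ x, (f x).size ≤ p.eval x.size := by
  obtain ⟨P, p, h⟩ := hf
  refine ⟨p, fun x => ?_⟩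
  have h1 := (h x).2
  rw [Prog.cost, (h x).1] at h1
  omega

theorem id : PolyTime fun x => x :=
  ⟨.id, X + X, fun x => by simp [Prog.eval, Prog.cost, Prog.subcost]⟩

theorem nil : PolyTime fun _ => Dat.nil :=
  ⟨.nil, X + 1, fun x => by simp [Prog.eval, Prog.cost, Prog.subcost, Dat.size]⟩

theorem comp {f g : Dat → Dat} (hf : PolyTime f) (hg : PolyTime g) : PolyTime fun x => f (g x) := by
  obtain ⟨q, hq⟩ := hg.size_le
  obtain ⟨r, hr⟩ := hf.size_le
  obtain ⟨P, p, hP⟩ := hf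
  obtain ⟨Q, p', hQ⟩ := hg
  refine ⟨.comp P Q, X + r.comp q + p' + p.comp q, fun x => ⟨?_, ?_⟩⟩
  · simp [Prog.eval, (hP _).1, (hQ _).1]
  · have h1 := (hP (g x)).2
    have h2 := (hQ x).2
    have h3 := (hr (g x)).trans (r.eval_nat_mono (hq x))
    have h4 := h1.trans (p.eval_nat_mono (hq x))
    simp only [Prog.cost, Prog.eval, Prog.subcost, (hP _).1, (hQ _).1, eval_add, eval_comp,
      eval_X] at *
    omega

theorem fst {f : Dat → Dat} (hf : PolyTime f) : PolyTime fun x => (f x).fst :=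
  comp (f := Dat.fst) ⟨.fst, X + X, fun x => by
    have := x.size_fst_le
    simp [Prog.eval, Prog.cost, Prog.subcost]; omega⟩ hf

theorem snd {f : Dat → Dat} (hf : PolyTime f) : PolyTime fun x => (f x).snd :=
  comp (f := Dat.snd) ⟨.snd, X + X, fun x => by
    have := x.size_snd_le
    simp [Prog.eval, Prog.cost, Prog.subcost]; omega⟩ hf

theorem cons {f g : Dat → Dat} (hf : PolyTime f) (hg : PolyTime g) :
    PolyTime fun x => Dat.cons (f x) (g x) := by
  obtain ⟨q, hq⟩ := hg.size_le
  obtain ⟨r, hr⟩ := hf.size_le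
  obtain ⟨P, p, hP⟩ := hf
  obtain ⟨Q, p', hQ⟩ := hg
  refine ⟨.pair P Q, X + (r + q + 1) + p' + p, fun x => ⟨?_, ?_⟩⟩
  · simp [Prog.eval, (hP _).1, (hQ _).1]
  · have h1 := (hP x).2
    have h2 := (hQ x).2
    have h3 := hr x
    have h4 := hq x
    simp only [Prog.cost, Prog.eval, Prog.subcost, (hP _).1, (hQ _).1, eval_add, eval_one,
      eval_X, Dat.size] at *
    omega

theorem const (d : Dat) : PolyTime fun _ => d := by
  induction d with
  | nil => exact nil
  | cons a b ha hb => exact ha.cons hb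

theorem ite_eq {f g p q : Dat → Dat} (hf : PolyTime f) (hg : PolyTime g) (hp : PolyTime p)
    (hq : PolyTime q) : PolyTime fun x => if f x = g x then p x else q x := by
  have heq : PolyTime fun x => Dat.ofBool (decide (f x = g x)) :=
    comp (f := fun x => Dat.ofBool (decide (x.fst = x.snd))) ⟨.eq, X + 3, fun x => by
      have : (Dat.ofBool (decide (x.fst = x.snd))).size ≤ 3 := by
        cases decide (x.fst = x.snd) <;> simp [Dat.ofBool, Dat.size]
      simp [Prog.eval, Prog.cost, Prog.subcost]; omega⟩ (hf.cons hg)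
  obtain ⟨T, t, hT⟩ := heq
  obtain ⟨bp, hbp⟩ := hp.size_le
  obtain ⟨bq, hbq⟩ := hq.size_le
  obtain ⟨P, pp, hP⟩ := hp
  obtain ⟨Q, pq, hQ⟩ := hq
  refine ⟨.ite T P Q, X + (bp + bq) + t + pp + pq, fun x => ?_⟩
  have h1 := (hT x).2
  have h2 := (hP x).2
  have h3 := (hQ x).2
  have h4 := hbp x
  have h5 := hbq x
  by_cases h : f x = g x
  · simp only [Prog.cost, Prog.eval, Prog.subcost, (hP _).1, (hQ _).1, (hT _).1, eval_add,
      eval_X, h, decide_true, Dat.ofBool, if_true, reduceCtorEq, if_false, true_and] at *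
    omega
  · simp only [Prog.cost, Prog.eval, Prog.subcost, (hP _).1, (hQ _).1, (hT _).1, eval_add,
      eval_X, h, decide_false, Dat.ofBool, if_true, if_false, true_and] at *
    omega

/-- The cost of an iteration depends on the accumulator at that moment, so the bound `M` is asked
for along the run, that is, after each proper prefix `l'` of the list. -/
theorem subcost_fold_le (B : Prog) (e acc : Dat) (l : List Dat) (M : ℕ)
    (hM : ∀ l' y, l' ++ [y] <+: l → B.cost (.cons e (.cons
      (l'.foldl (fun acc y => B.eval (.cons e (.cons acc y))) acc) y)) ≤ M) :
    (l.foldl (fun (st : Dat × ℕ) y =>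
          let z := Dat.cons e (.cons st.1 y)
          (B.eval z, st.2 + (z.size + (B.eval z).size + B.subcost z))) (acc, 0)).1 =
      l.foldl (fun acc y => B.eval (.cons e (.cons acc y))) acc ∧
    (l.foldl (fun (st : Dat × ℕ) y =>
          let z := Dat.cons e (.cons st.1 y)
          (B.eval z, st.2 + (z.size + (B.eval z).size + B.subcost z))) (acc, 0)).2 ≤
      l.length * M := by
  induction l using List.reverseRecOn with
  | nil => simp
  | append_singleton l y ih =>
    obtain ⟨h1, h2⟩ := ih fun l' y' h => hM l' y' (h.trans (List.prefix_append _ _))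
    have h3 := hM l y (List.prefix_refl _)
    simp only [List.foldl_append, List.foldl_cons, List.foldl_nil, List.length_append,
      List.length_singleton, h1] at *
    refine ⟨trivial, ?_⟩
    rw [Prog.cost] at h3
    rw [add_mul, one_mul]
    exact add_le_add h2 h3

/-- A loop is polynomial if all intermediate values of the accumulator are polynomially bounded. -/
theorem foldl {i l : Dat → Dat} {g : Dat → Dat → Dat → Dat} (hi : PolyTime i) (hl : PolyTime l)
    (hg : PolyTime fun z => g z.fst z.snd.fst z.snd.snd) (q : Polynomial ℕ)
    (hq : ∀ x l', l' <+: (l x).toList → (l'.foldl (g x) (i x)).size ≤ q.eval x.size) :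
    PolyTime fun x => (l x).toList.foldl (g x) (i x) := by
  obtain ⟨W, w, hW⟩ := id.cons (hi.cons hl)
  obtain ⟨bl, hbl⟩ := hl.size_le
  obtain ⟨B, pb, hB⟩ := hg
  have hBg : ∀ x, (fun acc y => B.eval (.cons x (.cons acc y))) = g x := fun x => by
    funext acc y
    rw [(hB _).1]; rfl
  -- `W` prepares the triple of environment, initial accumulator and list. One iteration reads a
  -- tree of size at most `X + q + bl + 2`, where `2` counts the two pairing nodes, and there are at
  -- most `bl` iterations.
  refine ⟨.comp (.fold B) W, X + q + w + (w + q + bl * pb.comp (X + q + bl + 2)),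
    fun x => ⟨?_, ?_⟩⟩
  · simp [Prog.eval, (hW x).1, Dat.fst_cons, Dat.snd_cons, hBg]
  · have h1 := (hW x).2
    have hw : (Prog.eval W x).size ≤ w.eval x.size := by
      rw [Prog.cost] at h1; omega
    have h2 := hq x _ (List.prefix_refl _)
    have h3 := (subcost_fold_le B x (i x) (l x).toList ((pb.comp (X + q + bl + 2)).eval x.size)
      (fun l' y h => ?_)).2
    · have h4 : (l x).toList.length * (pb.comp (X + q + bl + 2)).eval x.size ≤
          bl.eval x.size * (pb.comp (X + q + bl + 2)).eval x.size :=
        Nat.mul_le_mul_right _ ((l x).length_toList_le.trans (hbl x))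
      have h6 : Prog.eval (.fold B) (.cons x (.cons (i x) (l x))) =
        (l x).toList.foldl (g x) (i x) := by
        simp [Prog.eval, Dat.fst_cons, Dat.snd_cons, hBg]
      rw [Prog.cost] at h1 ⊢
      simp only [Prog.subcost, Prog.eval.eq_6]
      rw [(hW x).1] at h1 hw ⊢
      simp only [h6, Dat.fst_cons, Dat.snd_cons, eval_add, eval_mul, eval_X] at *
      omega
    · rw [hBg]
      refine (hB _).2.trans ?_
      rw [eval_comp]
      apply pb.eval_nat_mono
      have h7 := hq x l' ((List.prefix_append _ _).trans h)
      have h8 : y.size ≤ bl.eval x.size :=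
        (Dat.size_le_of_mem (h.subset (by simp))).trans (hbl x)
      simp only [Dat.size, eval_add, eval_X, eval_ofNat] at *
      omega

/-- A loop is polynomial if each iteration adds to the size of the accumulator at most a
polynomial in the sizes of the other data. -/
theorem foldl_of_size_le {i l : Dat → Dat} {g : Dat → Dat → Dat → Dat} (hi : PolyTime i)
    (hl : PolyTime l) (hg : PolyTime fun z => g z.fst z.snd.fst z.snd.snd) (q : Polynomial ℕ)
    (hq : ∀ x acc y, (g x acc y).size ≤ acc.size + q.eval (Dat.cons x y).size) :
    PolyTime fun x => (l x).toList.foldl (g x) (i x) := by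
  obtain ⟨bi, hbi⟩ := hi.size_le
  obtain ⟨bl, hbl⟩ := hl.size_le
  refine foldl hi hl hg (bi + bl * q.comp (X + bl + 1)) fun x l' h => ?_
  have key : (l'.foldl (g x) (i x)).size ≤
      (i x).size + l'.length * q.eval (x.size + bl.eval x.size + 1) := by
    induction l' using List.reverseRecOn with
    | nil => simp
    | append_singleton l' y ih =>
      have h1 := ih ((List.prefix_append _ _).trans h)
      have h2 := hq x (l'.foldl (g x) (i x)) y
      have h3 : y.size ≤ bl.eval x.size :=
        (Dat.size_le_of_mem (h.subset (by simp))).trans (hbl x)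
      have h4 : q.eval (Dat.cons x y).size ≤ q.eval (x.size + bl.eval x.size + 1) :=
        q.eval_nat_mono (by simp only [Dat.size]; omega)
      simp only [List.foldl_append, List.foldl_cons, List.foldl_nil, List.length_append,
        List.length_singleton, add_mul, one_mul]
      omega
  have h1 : l'.length ≤ bl.eval x.size :=
    h.length_le.trans ((l x).length_toList_le.trans (hbl x))
  have h2 := Nat.mul_le_mul_right (q.eval (x.size + bl.eval x.size + 1)) h1
  have h3 := hbi x
  simp only [eval_add, eval_mul, eval_comp, eval_X, eval_one]
  omega

theorem reverse {l : Dat → Dat} (hl : PolyTime l) :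
    PolyTime fun x => Dat.ofList (l x).toList.reverse := by
  have key : PolyTime fun x => (l x).toList.foldl (fun acc y => Dat.cons y acc) Dat.nil :=
    foldl_of_size_le (g := fun _ acc y => Dat.cons y acc) nil hl (id.snd.snd.cons id.snd.fst) X
      fun x acc y => by simp only [Dat.size, eval_X]; omega
  have h : ∀ (l : List Dat) (a : Dat), l.foldl (fun acc y => Dat.cons y acc) a =
      Dat.ofList (l.reverse ++ a.toList) := fun l => by
    induction l with
    | nil => simp
    | cons b l ih => intro a; simp [ih, Dat.toList]
  simpa [h, Dat.toList] using key

/-- The only cheap operation is to push at the front, so the first list is reversed and then pushed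
onto the second. -/
theorem append {l m : Dat → Dat} (hl : PolyTime l) (hm : PolyTime m) :
    PolyTime fun x => Dat.ofList ((l x).toList ++ (m x).toList) := by
  have key : PolyTime fun x => (Dat.ofList (l x).toList.reverse).toList.foldl
      (fun acc y => Dat.cons y acc) (m x) :=
    foldl_of_size_le (g := fun _ acc y => Dat.cons y acc) hm hl.reverse
      (id.snd.snd.cons id.snd.fst) X fun x acc y => by simp only [Dat.size, eval_X]; omega
  have h : ∀ (l : List Dat) (a : Dat), l.foldl (fun acc y => Dat.cons y acc) a =
      Dat.ofList (l.reverse ++ a.toList) := fun l => by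
    induction l with
    | nil => simp
    | cons b l ih => intro a; simp [ih, Dat.toList]
  simpa [h, Dat.toList] using key

/-- The loop runs through the reversed list and puts each block in front. An iteration adds only the
size of its own block, which does not depend on the accumulator. -/
theorem flatMap {l : Dat → Dat} {f : Dat → Dat → Dat} (hl : PolyTime l)
    (hf : PolyTime fun z => f z.fst z.snd) :
    PolyTime fun x => Dat.ofList ((l x).toList.flatMap fun y => (f x y).toList) := by
  obtain ⟨q, hq⟩ := hf.size_le
  have hf' : PolyTime fun z => f z.fst z.snd.snd := by
    have := hf.comp (id.fst.cons id.snd.snd)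
    simpa [Dat.fst_cons, Dat.snd_cons] using this
  have key : PolyTime fun x => (Dat.ofList (l x).toList.reverse).toList.foldl
      (fun acc y => Dat.ofList ((f x y).toList ++ acc.toList)) Dat.nil :=
    foldl_of_size_le (g := fun x acc y => Dat.ofList ((f x y).toList ++ acc.toList)) nil
      hl.reverse (hf'.append id.snd.fst) q fun x acc y => by
        have h1 := Dat.size_ofList_append (f x y).toList acc.toList
        have h2 := hq (Dat.cons x y)
        simp only [Dat.ofList_toList, Dat.fst_cons, Dat.snd_cons] at *
        omega
  have h : ∀ (g : Dat → Dat) (l : List Dat), l.reverse.foldl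
      (fun acc y => Dat.ofList ((g y).toList ++ acc.toList)) Dat.nil =
      Dat.ofList (l.flatMap fun y => (g y).toList) := fun g l => by
    induction l with
    | nil => simp [Dat.ofList]
    | cons b l ih => simp [List.foldl_append, ih]
  simpa [h] using key

theorem map {l : Dat → Dat} {f : Dat → Dat → Dat} (hl : PolyTime l)
    (hf : PolyTime fun z => f z.fst z.snd) :
    PolyTime fun x => Dat.ofList ((l x).toList.map (f x)) := by
  have := flatMap (f := fun x y => Dat.cons (f x y) Dat.nil) hl (hf.cons nil)
  simpa [Dat.toList, ← List.map_eq_flatMap] using this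

/-- Here the index list belongs to the program and not to the input: the loop over it is unrolled.
-/
theorem ofList_map {ι : Type*} {f : ι → Dat → Dat} (l : List ι) (hf : ∀ i, PolyTime (f i)) :
    PolyTime fun x => Dat.ofList (l.map fun i => f i x) := by
  induction l with
  | nil => exact nil
  | cons a l ih => exact (hf a).cons ih

theorem getD {l : Dat → Dat} (hl : PolyTime l) (i : ℕ) :
    PolyTime fun x => (l x).toList.getD i Dat.nil := by
  induction i generalizing l with
  | zero =>
    convert hl.fst using 2 with x
    cases l x <;> simp [Dat.toList, Dat.fst]
  | succ i ih =>
    convert ih hl.snd using 2 with x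
    cases l x <;> simp [Dat.toList, Dat.snd]

end PolyTime

/-! ### Suffixes, sublists and table lookup on trees -/

namespace Dat

/-- The suffixes of the list `x`, the shortest first. -/
def revTails (x : Dat) : Dat := ofList (x.toList.tails.reverse.map ofList)

/-- The sublists of length `j` of the list `x`. -/
def sublists (j : ℕ) (x : Dat) : Dat := ofList ((x.toList.sublistsLen j).map ofList)

/-- The value of the key `t` in the list `x` of pairs of a key and a value. -/
def lookup (x t : Dat) : Dat :=
  x.toList.foldl (fun acc y => if y.fst = t then y.snd else acc) nil

/-- The scan returns the last match. Since `K` is injective all matches carry the same value, so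
repetitions in `l` are harmless. -/
theorem lookup_map {ι : Type*} (l : List ι) (K V : ι → Dat) (hK : Function.Injective K)
    {i : ι} (hi : i ∈ l) : lookup (ofList (l.map fun i => cons (K i) (V i))) (K i) = V i := by
  have key : ∀ (m : List ι) (a : Dat), (i ∈ m ∨ a = V i) →
      (m.map fun i => cons (K i) (V i)).foldl
        (fun acc y => if y.fst = K i then y.snd else acc) a = V i := fun m => by
    induction m with
    | nil => intro a h; simpa using h
    | cons b m ih =>
      intro a h
      rw [List.map_cons, List.foldl_cons]
      apply ih
      by_cases hb : b = i
      · right; simp [hb]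
      · rcases h with h | h
        · left
          simpa [Ne.symm hb] using h
        · right
          simp [fst_cons, hK.ne hb, h]
  simpa [lookup] using key l nil (Or.inl hi)

/-- The accumulator is itself the list of suffixes found so far, with the current suffix at its
head; a step pushes the tail of the head. -/
theorem foldl_revTails (t r : List Dat) :
    t.foldl (fun acc _ => cons acc.fst.snd acc) (cons (ofList t) (ofList r)) =
      ofList (t.tails.reverse.map ofList ++ r) := by
  induction t generalizing r with
  | nil => simp [ofList]
  | cons a t ih =>
    have := ih (ofList (a :: t) :: r)
    simpa [ofList, fst_cons, snd_cons] using this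

end Dat

/-- Sublists are sorted by the suffix that their first element starts. Taking the shortest suffixes
first reproduces the order of `sublistsLen` exactly. -/
theorem List.sublistsLen_succ_eq_flatMap {α : Type*} (j : ℕ) (l : List α) :
    l.sublistsLen (j + 1) = l.tails.reverse.flatMap fun t =>
      match t with
      | [] => []
      | a :: t => (t.sublistsLen j).map (List.cons a) := by
  induction l with
  | nil => simp
  | cons a l ih => simp [List.sublistsLen_succ_cons, ih]

namespace PolyTime

open Polynomial

theorem revTails {l : Dat → Dat} (hl : PolyTime l) : PolyTime fun x => (l x).revTails := by
  obtain ⟨q, hq⟩ := hl.size_le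
  have key : PolyTime fun x => (l x).toList.foldl (fun acc _ => Dat.cons acc.fst.snd acc)
      (Dat.cons (l x) Dat.nil) := by
    -- The growth per step is the size of the head of the accumulator, so `foldl_of_size_le` does
    -- not apply; but the head is always a suffix of the input list, which gives a quadratic bound.
    refine foldl (g := fun _ acc _ => Dat.cons acc.fst.snd acc) (hl.cons nil) hl
      (id.snd.fst.fst.snd.cons id.snd.fst) (q + 2 + q * (q + 1)) fun x l' h => ?_
    have h0 : ∀ (m : List Dat) (a : Dat) (N : ℕ), a.fst.size ≤ N →
        (m.foldl (fun acc _ => Dat.cons acc.fst.snd acc) a).size ≤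
          a.size + m.length * (N + 1) := fun m => by
      induction m with
      | nil => simp
      | cons b m ih =>
        intro a N ha
        have h1 := a.fst.size_snd_le
        have h2 := ih (Dat.cons a.fst.snd a) N (by simp only [Dat.fst_cons]; omega)
        simp only [List.foldl_cons, List.length_cons, Dat.size, add_mul] at *
        omega
    have h1 := h0 l' (Dat.cons (l x) Dat.nil) (q.eval x.size) (by simpa using hq x)
    have h2 : l'.length * (q.eval x.size + 1) ≤ q.eval x.size * (q.eval x.size + 1) :=
      Nat.mul_le_mul_right _ (h.length_le.trans ((l x).length_toList_le.trans (hq x)))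
    have h3 := hq x
    simp only [eval_add, eval_mul, eval_one, eval_ofNat, Dat.size] at *
    omega
  convert key using 2 with x
  have := Dat.foldl_revTails (l x).toList []
  simp only [Dat.ofList_toList, List.append_nil] at this
  simpa [Dat.revTails, Dat.ofList] using this.symm

/-- Since `j` is fixed, induction on `j` builds a program of `j` nested loops; the degree of the
polynomial may grow with `j`. -/
theorem sublists {l : Dat → Dat} (j : ℕ) (hl : PolyTime l) :
    PolyTime fun x => (l x).sublists j := by
  suffices h : PolyTime (Dat.sublists j) from h.comp hl
  clear hl
  induction j with
  | zero =>
    convert const (Dat.cons Dat.nil Dat.nil) using 2 with x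
    simp [Dat.sublists, Dat.ofList]
  | succ j ih =>
    have key : PolyTime fun x => Dat.ofList (x.revTails.toList.flatMap fun t =>
        (if t = Dat.nil then Dat.nil else
          Dat.ofList ((t.snd.sublists j).toList.map fun y => Dat.cons t.fst y)).toList) :=
      flatMap (f := fun _ t => if t = Dat.nil then Dat.nil else
          Dat.ofList ((t.snd.sublists j).toList.map fun y => Dat.cons t.fst y)) id.revTails
        (ite_eq id.snd nil nil (map (f := fun z y => Dat.cons z.snd.fst y) (ih.comp id.snd.snd)
          (id.fst.snd.fst.cons id.snd)))
    convert key using 2 with x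
    rw [Dat.sublists, List.sublistsLen_succ_eq_flatMap, List.map_flatMap, Dat.revTails,
      Dat.toList_ofList, List.flatMap_map]
    congr 2
    funext t
    cases t <;> simp [Dat.ofList, Dat.fst_cons, Dat.snd_cons, Dat.toList, Dat.sublists]

theorem lookup {l t : Dat → Dat} (hl : PolyTime l) (ht : PolyTime t) :
    PolyTime fun x => (l x).lookup (t x) :=
  foldl_of_size_le (g := fun x acc y => if y.fst = t x then y.snd else acc) nil hl
    (ite_eq id.snd.snd.fst (ht.comp id.fst) id.snd.snd.snd id.snd.fst) X fun x acc y => by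
      have := y.size_snd_le
      simp only [eval_X, Dat.size]
      split <;> omega

end PolyTime

/-! ### Operations on circuits -/

/-- Renaming of the input symbols. -/
def Wire.reindex {a a' b : ℕ} (π : Fin a → Fin a') : Wire a b → Wire a' b
  | .input i j => .input (π i) j
  | .gate t => .gate t

/-- Renumbering of the gates. -/
def Wire.shift {a b : ℕ} (o : ℕ) : Wire a b → Wire a b
  | .input i j => .input i j
  | .gate t => .gate (o + t)

def Gate.reindex {a a' b : ℕ} (π : Fin a → Fin a') (g : Gate a b) : Gate a' b :=
  ⟨g.op, g.left.reindex π, g.right.reindex π⟩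

def Gate.shift {a b : ℕ} (o : ℕ) (g : Gate a b) : Gate a b :=
  ⟨g.op, g.left.shift o, g.right.shift o⟩

namespace Wire

variable {a a' b : ℕ}

theorem val_reindex (π : Fin a → Fin a') (x : Fin a' → Fin b → Bool) (vals : List Bool)
    (w : Wire a b) : (w.reindex π).val x vals = w.val (fun i => x (π i)) vals := by
  cases w <;> rfl

/-- This includes gates that are not computed yet: both sides then read `false`. -/
theorem val_shift (x : Fin a → Fin b → Bool) (pre vals : List Bool) (w : Wire a b) :
    (w.shift pre.length).val x (pre ++ vals) = w.val x vals := by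
  cases w with
  | input => rfl
  | gate t =>
    rw [shift, val, List.getD_append_right _ _ _ _ (Nat.le_add_right _ _), Nat.add_sub_cancel_left,
      val]

end Wire

namespace Circuit

variable {a a' b : ℕ}

theorem gateVals_concat (gs : List (Gate a b)) (g : Gate a b) (x : Fin a → Fin b → Bool) :
    gateVals (gs ++ [g]) x = gateVals gs x ++
      [g.op (g.left.val x (gateVals gs x)) (g.right.val x (gateVals gs x))] := by
  simp [gateVals]

theorem length_gateVals (gs : List (Gate a b)) (x : Fin a → Fin b → Bool) :
    (gateVals gs x).length = gs.length := by
  induction gs using List.reverseRecOn with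
  | nil => rfl
  | append_singleton gs g ih => simp [gateVals_concat, ih]

/-- After the shift the second block refers to its own gates only, so it computes as if it stood
alone. -/
theorem gateVals_append_shift (pre gs : List (Gate a b)) (x : Fin a → Fin b → Bool) :
    gateVals (pre ++ gs.map (Gate.shift pre.length)) x = gateVals pre x ++ gateVals gs x := by
  induction gs using List.reverseRecOn with
  | nil => simp [gateVals]
  | append_singleton gs g ih =>
    rw [List.map_append, ← List.append_assoc, List.map_singleton, gateVals_concat, ih,
      gateVals_concat, List.append_assoc]
    simp [Gate.shift, ← length_gateVals pre x, Wire.val_shift]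

def reindex (π : Fin a → Fin a') (C : Circuit a b) : Circuit a' b :=
  ⟨C.gates.map (Gate.reindex π), C.out.reindex π⟩

@[simp] theorem size_reindex (π : Fin a → Fin a') (C : Circuit a b) :
    (C.reindex π).size = C.size := by simp [reindex, size]

theorem gateVals_reindex (π : Fin a → Fin a') (gs : List (Gate a b))
    (x : Fin a' → Fin b → Bool) :
    gateVals (gs.map (Gate.reindex π)) x = gateVals gs fun i => x (π i) := by
  induction gs using List.reverseRecOn with
  | nil => rfl
  | append_singleton gs g ih =>
    rw [List.map_append, List.map_singleton, gateVals_concat, ih, gateVals_concat]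
    simp [Gate.reindex, Wire.val_reindex]

theorem eval_reindex (π : Fin a → Fin a') (C : Circuit a b) (x : Fin a' → Fin b → Bool) :
    (C.reindex π).eval x = C.eval fun i => x (π i) := by
  simp [eval, reindex, gateVals_reindex, Wire.val_reindex]

theorem Decides.eval_reindex_iff {Sig : Type} {enc : Sig ↪ (Fin b → Bool)}
    {C : Circuit a b} {S : Set (Fin a → Sig)} (h : C.Decides enc S) (π : Fin a → Fin a')
    (σ : Fin a' → Sig) :
    (C.reindex π).eval (fun i => enc (σ i)) = true ↔ (fun i => σ (π i)) ∈ S := by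
  rw [eval_reindex, ← h]

/-- The total size of a list of circuits. -/
def totalSize (l : List (Circuit a b)) : ℕ := (l.map size).sum

/-- The gates of the conjunction of a list of circuits: the last gate outputs the conjunction. -/
def allGates : List (Circuit a b) → List (Gate a b)
  | [] => [⟨fun _ _ => true, .gate 0, .gate 0⟩]
  | C :: l => allGates l ++ (C.gates.map (Gate.shift (totalSize l + 1)) ++
      [⟨and, C.out.shift (totalSize l + 1), .gate (totalSize l)⟩])

/-- The conjunction of a list of circuits. -/
def all (l : List (Circuit a b)) : Circuit a b := ⟨allGates l, .gate (totalSize l)⟩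

/-- `size` counts one node more than the gates, and this node pays for the `and` gate added per
circuit. Hence the last gate has number `totalSize l`, also for `l = []`, where it is the constant
gate. -/
theorem length_allGates (l : List (Circuit a b)) : (allGates l).length = totalSize l + 1 := by
  induction l with
  | nil => rfl
  | cons C l ih =>
    simp only [allGates, List.length_append, ih, List.length_map, List.length_singleton,
      totalSize, List.map_cons, List.sum_cons, size]
    omega

theorem size_all (l : List (Circuit a b)) : (all l).size = totalSize l + 2 := by
  simp [size, all, length_allGates]

theorem eval_all (l : List (Circuit a b)) (x : Fin a → Fin b → Bool) :
    (all l).eval x = true ↔ ∀ C ∈ l, C.eval x = true := by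
  suffices h : (gateVals (allGates l) x).getD (totalSize l) false = true ↔
      ∀ C ∈ l, C.eval x = true from h
  induction l with
  | nil => simp [allGates, totalSize, gateVals]
  | cons C l ih =>
    have h1 : gateVals (allGates (C :: l)) x = gateVals (allGates l) x ++ gateVals C.gates x ++
        [C.eval x && (gateVals (allGates l) x).getD (totalSize l) false] := by
      have h2 : totalSize l + 1 = (gateVals (allGates l) x).length := by
        rw [length_gateVals, length_allGates]
      have h4 : (Wire.gate (totalSize l)).val x (gateVals (allGates l) x ++ gateVals C.gates x) =
          (gateVals (allGates l) x).getD (totalSize l) false := by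
        rw [Wire.val, List.getD_append _ _ _ _ (by omega)]
      rw [allGates, ← List.append_assoc, gateVals_concat, ← length_allGates,
        gateVals_append_shift, h4, length_allGates, h2, Wire.val_shift]
      rfl
    have h3 : totalSize (C :: l) = (gateVals (allGates l) x ++ gateVals C.gates x).length := by
      simp only [List.length_append, length_gateVals, length_allGates, totalSize, List.map_cons,
        List.sum_cons, size]
      omega
    rw [h1, h3, List.getD_append_right _ _ _ _ le_rfl]
    simp only [Nat.sub_self, List.getD_cons_zero, Bool.and_eq_true, List.mem_cons,
      forall_eq_or_imp, ih]

end Circuit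

/-! ### Operations on codes of circuits -/

namespace Dat

/-- The code of a wire with its input symbol renamed: `0` becomes `i`, all others become `j`. -/
def wireReindex (i j w : Dat) : Dat :=
  if w.fst = nil then cons nil (cons (if w.snd.fst = nil then i else j) w.snd.snd) else w

def circuitReindex (i j C : Dat) : Dat :=
  cons (ofList (C.fst.toList.map fun g =>
    cons g.fst (cons (wireReindex i j g.snd.fst) (wireReindex i j g.snd.snd))))
    (wireReindex i j C.snd)

/-- The code of a wire with its gate number increased by `o`. -/
def wireShift (o w : Dat) : Dat :=
  if w.fst = nil then w else cons w.fst (ofList (o.toList ++ w.snd.toList))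

/-- The total size of a list of codes of circuits, in unary. -/
def totalSize (l : Dat) : Dat :=
  ofList (l.toList.flatMap fun C => (cons nil (ofList (C.fst.toList.map fun _ => nil))).toList)

/-- The code of the conjunction of a list of codes of circuits. -/
def circuitAll (l : Dat) : Dat :=
  cons
    (cons (Gate.toDat (a := 0) (b := 0) ⟨fun _ _ => true, .gate 0, .gate 0⟩)
      (ofList (l.revTails.toList.flatMap fun t => (if t = nil then nil else
        ofList ((ofList (t.fst.fst.toList.map fun g =>
          cons g.fst (cons (wireShift (cons nil t.snd.totalSize) g.snd.fst)
            (wireShift (cons nil t.snd.totalSize) g.snd.snd)))).toList ++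
          (cons (cons (ofList [ofBool false, ofBool false, ofBool false, ofBool true])
            (cons (wireShift (cons nil t.snd.totalSize) t.fst.snd)
              (cons (ofBool true) t.snd.totalSize))) nil).toList)).toList)))
    (cons (ofBool true) l.totalSize)

theorem ofNat_add (m k : ℕ) : ofNat (m + k) = ofList ((ofNat m).toList ++ (ofNat k).toList) := by
  rw [toList_ofNat, toList_ofNat, List.replicate_append_replicate, ofNat_eq_ofList]

@[simp] theorem toList_nil : nil.toList = [] := rfl

@[simp] theorem toList_cons (x y : Dat) : (cons x y).toList = x :: y.toList := rfl

end Dat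

section

variable {a a' b : ℕ}

/-- Two target codes suffice because only circuits on one or two symbols get renamed. -/
theorem Dat.wireReindex_toDat (π : Fin a → Fin a') (i j : Dat)
    (hi : ∀ t : Fin a, (t : ℕ) = 0 → .ofNat (π t) = i)
    (hj : ∀ t : Fin a, (t : ℕ) ≠ 0 → .ofNat (π t) = j) (w : Wire a b) :
    wireReindex i j w.toDat = (w.reindex π).toDat := by
  cases w with
  | gate t => simp [wireReindex, Wire.toDat, Wire.reindex, ofBool]
  | input t u =>
    have : (Dat.ofNat (t : ℕ) = nil) ↔ (t : ℕ) = 0 := by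
      rw [show nil = Dat.ofNat 0 from rfl, ofNat_inj]
    by_cases h : (t : ℕ) = 0
    · simp only [wireReindex, Wire.toDat, Wire.reindex, fst_cons, snd_cons, this.2 h, hi t h, if_true]
    · simp only [wireReindex, Wire.toDat, Wire.reindex, fst_cons, snd_cons, this, h, hj, if_true,
        if_false, ne_eq, not_false_eq_true]

theorem Dat.circuitReindex_toDat (π : Fin a → Fin a') (i j : Dat)
    (hi : ∀ t : Fin a, (t : ℕ) = 0 → .ofNat (π t) = i)
    (hj : ∀ t : Fin a, (t : ℕ) ≠ 0 → .ofNat (π t) = j) (C : Circuit a b) :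
    circuitReindex i j C.toDat = (C.reindex π).toDat := by
  simp [circuitReindex, Circuit.toDat, Circuit.reindex, Gate.toDat, Gate.reindex,
    wireReindex_toDat π i j hi hj, Function.comp_def]

theorem Dat.wireShift_toDat (o : ℕ) (w : Wire a b) :
    wireShift (.ofNat o) w.toDat = (w.shift o).toDat := by
  cases w with
  | input t u => simp [wireShift, Wire.toDat, Wire.shift]
  | gate t =>
    rw [Wire.shift, Wire.toDat, Wire.toDat, ofNat_add]
    simp [wireShift, ofBool]

theorem Dat.totalSize_toDat (l : List (Circuit a b)) :
    totalSize (ofList (l.map Circuit.toDat)) = .ofNat (Circuit.totalSize l) := by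
  rw [totalSize, toList_ofList, ofNat_eq_ofList]
  congr 1
  induction l with
  | nil => rfl
  | cons C l ih =>
    rw [List.map_cons, List.flatMap_cons, ih, Circuit.totalSize, Circuit.totalSize,
      List.map_cons, List.sum_cons, ← List.replicate_append_replicate]
    congr 1
    simp [Circuit.toDat, Circuit.size, List.replicate_succ, Function.comp_def]

/-- The block that `allGates` appends for `C :: l` depends on `l` only through `totalSize l`. Thus
the gate list is a concatenation over the suffixes of the list, the shortest first, and a `flatMap`
over `revTails` produces it. -/
theorem Dat.circuitAll_toDat (l : List (Circuit a b)) :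
    circuitAll (ofList (l.map Circuit.toDat)) = (Circuit.all l).toDat := by
  rw [circuitAll, Circuit.all, Circuit.toDat, totalSize_toDat, revTails, toList_ofList,
    toList_ofList, Wire.toDat]
  congr 1
  have key : ∀ l : List (Circuit a b), (Circuit.allGates l).map Gate.toDat =
      Gate.toDat (a := 0) (b := 0) ⟨fun _ _ => true, .gate 0, .gate 0⟩ ::
        l.tails.reverse.flatMap fun t => match t with
          | [] => []
          | C :: l => (C.gates.map (Gate.shift (Circuit.totalSize l + 1)) ++
              [(⟨and, C.out.shift (Circuit.totalSize l + 1),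
                .gate (Circuit.totalSize l)⟩ : Gate a b)]).map Gate.toDat := fun l => by
    induction l with
    | nil => rfl
    | cons C l ih =>
      rw [Circuit.allGates, List.map_append, ih]
      simp
  rw [key, ofList]
  congr 2
  have htails : (l.map Circuit.toDat).tails = l.tails.map (List.map Circuit.toDat) := by
    induction l with
    | nil => rfl
    | cons C l ih => simp [ih]
  rw [htails, ← List.map_reverse, List.flatMap_map, List.flatMap_map]
  congr 1
  funext t
  cases t with
  | nil => simp [ofList]
  | cons C l =>
    have h1 : cons nil (.ofNat (Circuit.totalSize l)) = .ofNat (Circuit.totalSize l + 1) := rfl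
    simp only [List.map_cons, ofList, reduceCtorEq, if_false, fst_cons, snd_cons,
      totalSize_toDat, h1, toList_ofList, toList_cons, toList_nil, Circuit.toDat,
      wireShift_toDat, List.map_append, List.map_map, List.map_nil]
    congr 1
    · refine List.map_congr_left fun g _ => ?_
      simp [Gate.toDat, Gate.shift, wireShift_toDat]

end

namespace PolyTime

variable {i j o w l : Dat → Dat}

theorem wireReindex (hi : PolyTime i) (hj : PolyTime j) (hw : PolyTime w) :
    PolyTime fun x => Dat.wireReindex (i x) (j x) (w x) :=
  ite_eq hw.fst nil (nil.cons ((ite_eq hw.snd.fst nil hi hj).cons hw.snd.snd)) hw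

theorem circuitReindex (hi : PolyTime i) (hj : PolyTime j) (hw : PolyTime w) :
    PolyTime fun x => Dat.circuitReindex (i x) (j x) (w x) :=
  cons (map (f := fun x g => Dat.cons g.fst (Dat.cons (Dat.wireReindex (i x) (j x) g.snd.fst)
      (Dat.wireReindex (i x) (j x) g.snd.snd))) hw.fst
    (id.snd.fst.cons ((wireReindex (hi.comp id.fst) (hj.comp id.fst) id.snd.snd.fst).cons
      (wireReindex (hi.comp id.fst) (hj.comp id.fst) id.snd.snd.snd))))
    (wireReindex hi hj hw.snd)

theorem wireShift (ho : PolyTime o) (hw : PolyTime w) :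
    PolyTime fun x => Dat.wireShift (o x) (w x) :=
  ite_eq hw.fst nil hw (hw.fst.cons (ho.append hw.snd))

theorem totalSize (hl : PolyTime l) : PolyTime fun x => (l x).totalSize :=
  flatMap (f := fun _ C => Dat.cons Dat.nil (Dat.ofList (C.fst.toList.map fun _ => Dat.nil))) hl
    (nil.cons (map (f := fun _ _ => Dat.nil) id.snd.fst nil))

theorem circuitAll (hl : PolyTime l) : PolyTime fun x => (l x).circuitAll := by
  have hsize : PolyTime fun z => Dat.cons Dat.nil z.fst.snd.snd.totalSize :=
    nil.cons id.fst.snd.snd.totalSize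
  have hmap : PolyTime fun z => Dat.ofList (z.snd.fst.fst.toList.map fun g =>
      Dat.cons g.fst (Dat.cons (Dat.wireShift (Dat.cons Dat.nil z.snd.snd.totalSize) g.snd.fst)
        (Dat.wireShift (Dat.cons Dat.nil z.snd.snd.totalSize) g.snd.snd))) :=
    map (f := fun z g => Dat.cons g.fst (Dat.cons
        (Dat.wireShift (Dat.cons Dat.nil z.snd.snd.totalSize) g.snd.fst)
        (Dat.wireShift (Dat.cons Dat.nil z.snd.snd.totalSize) g.snd.snd))) id.snd.fst.fst
      (id.snd.fst.cons ((wireShift hsize id.snd.snd.fst).cons (wireShift hsize id.snd.snd.snd)))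
  have hlast : PolyTime fun z => Dat.cons
      (Dat.cons (Dat.ofList [.ofBool false, .ofBool false, .ofBool false, .ofBool true])
        (Dat.cons (Dat.wireShift (Dat.cons Dat.nil z.snd.snd.totalSize) z.snd.fst.snd)
          (Dat.cons (Dat.ofBool true) z.snd.snd.totalSize))) Dat.nil :=
    ((const _).cons ((wireShift (nil.cons id.snd.snd.totalSize) id.snd.fst.snd).cons
      ((const _).cons id.snd.snd.totalSize))).cons nil
  refine ((const _).cons (flatMap hl.revTails ?_)).cons ((const _).cons hl.totalSize)
  exact ite_eq id.snd nil nil (hmap.append hlast)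

end PolyTime

/-! ### Lists of faces -/

theorem List.map_sublistsLen {α β : Type*} (f : α → β) (j : ℕ) (l : List α) :
    (l.map f).sublistsLen j = (l.sublistsLen j).map (List.map f) := by
  induction l generalizing j with
  | nil => cases j <;> simp
  | cons a l ih =>
    cases j with
    | zero => simp
    | succ j => simp [List.sublistsLen_succ_cons, ih, Function.comp_def]

namespace PureComplex

variable {n d : ℕ} (X : PureComplex n d)

theorem mem_faces_of_subset {A B : Finset (Fin n)} (hA : A ∈ X.faces) (hBA : B ⊆ A)
    (hB : B.Nonempty) : B ∈ X.faces :=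
  (X.isRelLowerSet_faces hA).2 hBA hB

variable {X} {k m : ℕ}

theorem vert_mem {i : ℕ} (A : X.Face i) (t : Fin i) : X.vert A t ∈ A.1 :=
  A.1.orderEmbOfFin_mem A.2.2 t

theorem exists_vert_eq {i : ℕ} (A : X.Face i) {v : Fin n} (hv : v ∈ A.1) :
    ∃ t, X.vert A t = v := by
  have h : v ∈ Set.range (A.1.orderEmbOfFin A.2.2) := by
    rw [Finset.range_orderEmbOfFin]; exact hv
  exact h

theorem faceDat_eq (A : X.Face m) :
    X.faceDat A = .ofList (A.1.sort.map fun v : Fin n => .ofNat (v : ℕ)) := by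
  have h := Finset.listMap_orderEmbOfFin_finRange A.1 A.2.2
  rw [faceDat, ← h, List.map_map, List.ofFn_eq_map]
  rfl

def mkFace (A : Finset (Fin n)) (h : A ∈ X.faces ∧ A.card = k) : X.Face k := ⟨A, h⟩

/-- The `k`-faces contained in the face `D`. -/
noncomputable def subfaces (hk : 0 < k) (D : X.Face m) : List (X.Face k) :=
  (D.1.sort.sublistsLen k).pmap (fun l h => mkFace l.toFinset h) fun l hl => by
    obtain ⟨h1, h2⟩ := List.mem_sublistsLen.1 hl
    have h3 : l.toFinset.card = k := by
      rw [List.toFinset_card_of_nodup (h1.nodup (Finset.sort_nodup _ _)), h2]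
    refine ⟨X.mem_faces_of_subset D.2.1 (fun v hv => ?_) (Finset.card_pos.1 (by omega)), h3⟩
    exact (Finset.mem_sort _).1 (h1.subset (List.mem_toFinset.1 hv))

theorem map_val_subfaces (hk : 0 < k) (D : X.Face m) :
    (subfaces hk D).map (fun A => A.1) = (D.1.sort.sublistsLen k).map List.toFinset := by
  rw [subfaces, List.map_pmap]
  exact List.pmap_eq_map (f := List.toFinset) _

theorem toFinset_sort_of_mem_sublistsLen {D : Finset (Fin n)} {l : List (Fin n)}
    (hl : l ∈ D.sort.sublistsLen k) : l.toFinset.sort = l := by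
  have h1 := (List.mem_sublistsLen.1 hl).1
  exact (List.toFinset_sort (· ≤ ·) (h1.nodup (Finset.sort_nodup _ _))).2
    ((Finset.pairwise_sort D (· ≤ ·)).sublist h1)

/-- Faces are coded by sorted lists and a sublist of a sorted list is sorted, so the sublists
computed on trees are the codes of the subfaces, in the same order. -/
theorem map_faceDat_subfaces (hk : 0 < k) (D : X.Face m) :
    (subfaces hk D).map X.faceDat = (Dat.sublists k (X.faceDat D)).toList := by
  have h1 : (subfaces hk D).map X.faceDat = ((subfaces hk D).map fun A => A.1).map
      fun A => .ofList (A.sort.map fun v : Fin n => .ofNat (v : ℕ)) := by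
    rw [List.map_map]
    exact List.map_congr_left fun A _ => faceDat_eq A
  rw [h1, map_val_subfaces, Dat.sublists, Dat.toList_ofList, faceDat_eq, Dat.toList_ofList,
    List.map_sublistsLen, List.map_map, List.map_map]
  refine List.map_congr_left fun l hl => ?_
  simp only [toFinset_sort_of_mem_sublistsLen hl, Function.comp_apply]

theorem mem_subfaces (hk : 0 < k) (D : X.Face m) (A : X.Face k) :
    A ∈ subfaces hk D ↔ A.1 ⊆ D.1 := by
  have h1 : A ∈ subfaces hk D ↔ A.1 ∈ (subfaces hk D).map fun A => A.1 :=
    (List.mem_map_of_injective Subtype.val_injective).symm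
  rw [h1, map_val_subfaces, List.mem_map]
  constructor
  · rintro ⟨l, hl, h⟩ v hv
    rw [← h] at hv
    exact (Finset.mem_sort _).1
      ((List.mem_sublistsLen.1 hl).1.subset (List.mem_toFinset.1 hv))
  · intro h
    refine ⟨A.1.sort, List.mem_sublistsLen.2 ⟨?_, ?_⟩, Finset.sort_toFinset _ _⟩
    · refine List.sublist_of_subperm_of_pairwise (r := (· ≤ ·))
        ((List.subperm_of_subset (Finset.sort_nodup _ _) fun v hv => ?_))
        (Finset.pairwise_sort _ _) (Finset.pairwise_sort _ _)
      exact (Finset.mem_sort _).2 (h ((Finset.mem_sort _).1 hv))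
    · rw [Finset.length_sort]
      exact A.2.2

theorem nodup_subfaces (hk : 0 < k) (D : X.Face m) : (subfaces hk D).Nodup := by
  refine List.Nodup.of_map (fun A => A.1) ?_
  rw [map_val_subfaces]
  refine List.Nodup.map_on (fun l hl l' hl' h => ?_)
    (List.nodup_sublistsLen _ (Finset.sort_nodup _ _))
  rw [← toFinset_sort_of_mem_sublistsLen hl, h, toFinset_sort_of_mem_sublistsLen hl']

theorem length_subfaces (hk : 0 < k) (D : X.Face m) :
    (subfaces hk D).length = m.choose k := by
  have h1 := congrArg List.length (map_val_subfaces hk D)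
  have h2 : D.1.card = m := D.2.2
  rwa [List.length_map, List.length_map, List.length_sublistsLen, Finset.length_sort, h2] at h1

end PureComplex

/-! ### The circuit of a face -/

/-- The pairs `i < j` of positions in a word of length `k`. -/
noncomputable def positionPairs (k : ℕ) : List (Fin k × Fin k) :=
  (Finset.univ.filter fun p : Fin k × Fin k => p.1 < p.2).toList

theorem mem_positionPairs {k : ℕ} {p : Fin k × Fin k} : p ∈ positionPairs k ↔ p.1 < p.2 := by
  simp [positionPairs]

theorem length_positionPairs_le (k : ℕ) : (positionPairs k).length ≤ k ^ 2 := by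
  rw [positionPairs, Finset.length_toList]
  refine (Finset.card_filter_le _ _).trans ?_
  simp [sq]

namespace PureComplex

variable {n d : ℕ} {X : PureComplex n d} {k b : ℕ}

theorem mem_graph_edges {e : Fin n × Fin n} :
    e ∈ X.graph.edges ↔ e.1 < e.2 ∧ ({e.1, e.2} : Finset (Fin n)) ∈ X.faces := by
  simp [graph]

theorem vert_pair_mem_edges (A : X.Face k) {i j : Fin k} (h : i < j) :
    (X.vert A i, X.vert A j) ∈ X.graph.edges := by
  refine mem_graph_edges.2 ⟨(X.vert A).lt_iff_lt.2 h, X.mem_faces_of_subset A.2.1 ?_ ?_⟩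
  · intro v hv
    simp only [Finset.mem_insert, Finset.mem_singleton] at hv
    rcases hv with rfl | rfl <;> exact vert_mem A _
  · exact ⟨_, Finset.mem_insert_self _ _⟩

/-- The labellings of `A` that satisfy all edges of `A`. -/
def satisfyingLabels {Sig : Type} (Ψ : GenCSP X.graph Sig) (A : X.Face k) : Set (Fin k → Sig) :=
  {σ | ∀ i j, i < j → σ i ∈ Ψ.alphabet (X.vert A i) ∧ σ j ∈ Ψ.alphabet (X.vert A j) ∧
    (σ i, σ j) ∈ Ψ.constraint (X.vert A i, X.vert A j)}

/-- The checks of all edges of `A`, and of the alphabets of their ends. -/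
noncomputable def faceChecks (vc : Fin n → Circuit 1 b) (ec : Fin n × Fin n → Circuit 2 b)
    (A : X.Face k) : List (Circuit k b) :=
  (positionPairs k).map (fun p => (ec (X.vert A p.1, X.vert A p.2)).reindex ![p.1, p.2]) ++
    ((positionPairs k).map (fun p => (vc (X.vert A p.1)).reindex fun _ => p.1) ++
      (positionPairs k).map (fun p => (vc (X.vert A p.2)).reindex fun _ => p.2))

theorem decides_all_faceChecks {Sig : Type} {enc : Sig ↪ (Fin b → Bool)} {Ψ : GenCSP X.graph Sig}
    {vc : Fin n → Circuit 1 b} {ec : Fin n × Fin n → Circuit 2 b}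
    (hv : ∀ u, (vc u).Decides enc (Ψ.vertexSet u))
    (he : ∀ e ∈ X.graph.edges, (ec e).Decides enc (Ψ.edgeSet e)) (A : X.Face k) :
    (Circuit.all (faceChecks vc ec A)).Decides enc (satisfyingLabels Ψ A) := by
  intro σ
  rw [Circuit.eval_all]
  simp only [faceChecks, List.forall_mem_append, List.forall_mem_map, mem_positionPairs,
    (hv _).eval_reindex_iff, Prod.forall]
  -- Edge circuits are only known to be correct on edges of `X`, which is why `i < j` is needed.
  have key : ∀ i j : Fin k, i < j → (((ec (X.vert A i, X.vert A j)).reindex ![i, j]).eval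
      (fun t => enc (σ t)) = true ↔ (σ i, σ j) ∈ Ψ.constraint (X.vert A i, X.vert A j)) :=
    fun i j h => (he _ (vert_pair_mem_edges A h)).eval_reindex_iff _ σ
  constructor
  · rintro ⟨h1, h2, h3⟩ i j hij
    exact ⟨h2 i j hij, h3 i j hij, (key i j hij).1 (h1 i j hij)⟩
  · intro h
    exact ⟨fun i j hij => (key i j hij).2 (h i j hij).2.2, fun i j hij => (h i j hij).1,
      fun i j hij => (h i j hij).2.1⟩

theorem size_all_faceChecks_le {vc : Fin n → Circuit 1 b} {ec : Fin n × Fin n → Circuit 2 b}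
    (hk : 2 ≤ k) {M : ℕ}
    (hM : ∀ e ∈ X.graph.edges, (ec e).size + (vc e.1).size + (vc e.2).size ≤ M) (A : X.Face k) :
    (Circuit.all (faceChecks vc ec A)).size ≤ 3 * k ^ 2 * M := by
  have h1 : Circuit.totalSize (faceChecks vc ec A) ≤ k ^ 2 * M := by
    simp only [Circuit.totalSize, faceChecks, List.map_append, List.map_map, List.sum_append,
      ← List.sum_map_add, Function.comp_def, Circuit.size_reindex]
    refine (List.sum_le_card_nsmul _ M fun x hx => ?_).trans ?_
    · obtain ⟨p, hp, rfl⟩ := List.mem_map.1 hx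
      have := hM _ (vert_pair_mem_edges A (mem_positionPairs.1 hp))
      simp only at this ⊢
      omega
    · rw [List.length_map, smul_eq_mul]
      exact Nat.mul_le_mul_right _ (length_positionPairs_le k)
  -- An edge has three circuits of size at least one each, and `A` has an edge since `k ≥ 2`. This
  -- absorbs the two extra nodes of `Circuit.all`.
  have h2 : 3 ≤ M := by
    refine le_trans ?_ (hM _ (vert_pair_mem_edges A (i := ⟨0, by omega⟩) (j := ⟨1, by omega⟩)
      (by simp [Fin.lt_def])))
    simp only [Circuit.size]
    omega
  have h3 : 1 ≤ k ^ 2 := Nat.one_le_pow _ _ (by omega)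
  rw [Circuit.size_all]
  nlinarith

theorem faceDat_getD (A : X.Face k) (i : Fin k) :
    (X.faceDat A).toList.getD i Dat.nil = .ofNat (X.vert A i : ℕ) := by
  rw [faceDat, Dat.toList_ofList, List.getD_eq_getElem _ _ (by simp)]
  simp

end PureComplex

/-! ### The program that writes the Label Cover instance -/

/-- The code of the circuit of the face coded by `a`, from the tables of the circuits of the
vertices and of the edges. -/
noncomputable def Dat.faceCircuit (k : ℕ) (vt et a : Dat) : Dat :=
  circuitAll (ofList
    ((ofList ((positionPairs k).map fun p => circuitReindex (ofNat p.1) (ofNat p.2)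
        (lookup et (cons (a.toList.getD p.1 nil) (a.toList.getD p.2 nil))))).toList ++
      (ofList ((ofList ((positionPairs k).map fun p => circuitReindex (ofNat p.1) (ofNat p.1)
          (lookup vt (a.toList.getD p.1 nil)))).toList ++
        (ofList ((positionPairs k).map fun p => circuitReindex (ofNat p.2) (ofNat p.2)
          (lookup vt (a.toList.getD p.2 nil)))).toList)).toList))

theorem PolyTime.faceCircuit (k : ℕ) {vt et a : Dat → Dat} (hv : PolyTime vt) (he : PolyTime et)
    (ha : PolyTime a) : PolyTime fun x => Dat.faceCircuit k (vt x) (et x) (a x) := by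
  refine circuitAll (append ?_ (append ?_ ?_)) <;> refine ofList_map _ fun p => ?_
  · exact circuitReindex (const _) (const _) (lookup he ((ha.getD _).cons (ha.getD _)))
  · exact circuitReindex (const _) (const _) (lookup hv (ha.getD _))
  · exact circuitReindex (const _) (const _) (lookup hv (ha.getD _))

/-- The code of the Label Cover instance, from the code of the 2-CSP. -/
noncomputable def Dat.labelCover (k s : ℕ) (x : Dat) : Dat :=
  cons x.fst
    (cons (ofList (x.snd.fst.toList.flatMap fun D => (ofList ((D.sublists k).toList.flatMap
        fun A => (ofList ((A.sublists s).toList.map fun B => cons A B)).toList)).toList))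
      (cons (ofList (x.snd.fst.toList.flatMap fun D => (ofList ((D.sublists k).toList.map
        fun A => cons A (faceCircuit k x.snd.snd.fst x.snd.snd.snd.fst A))).toList)) nil))

theorem PolyTime.labelCover (k s : ℕ) : PolyTime (Dat.labelCover k s) := by
  refine id.fst.cons ((flatMap id.snd.fst (flatMap (id.snd.sublists k)
    (map (id.snd.sublists s) (id.fst.snd.cons id.snd)))).cons
    ((flatMap id.snd.fst (map (id.snd.sublists k) ?_)).cons nil))
  exact id.snd.cons (faceCircuit k id.fst.fst.snd.snd.fst id.fst.fst.snd.snd.snd.fst id.snd)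

namespace CSPCode

variable {n d : ℕ} {X : PureComplex n d} {b k s : ℕ}

open PureComplex

/-- The Label Cover instance produced from a 2-CSP. -/
noncomputable def labelCover (code : CSPCode X b) (hk : 0 < k) (hs : 0 < s) :
    LabelCoverCode X k s b where
  edges := code.tops.flatMap fun D => (subfaces hk D).flatMap fun A =>
    (subfaces hs A).map fun B => (A, B)
  left := code.tops.flatMap fun D => (subfaces hk D).map fun A =>
    (A, Circuit.all (faceChecks code.vertexCircuit code.edgeCircuit A))

theorem lookup_vertexCircuit (code : CSPCode X b) (u : Fin n) :
    Dat.lookup (.ofList ((List.finRange n).map fun u : Fin n =>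
      .cons (.ofNat (u : ℕ)) (code.vertexCircuit u).toDat)) (.ofNat (u : ℕ)) =
      (code.vertexCircuit u).toDat :=
  Dat.lookup_map (List.finRange n) (fun u : Fin n => .ofNat (u : ℕ))
    (fun u => (code.vertexCircuit u).toDat) (Dat.ofNat_injective.comp Fin.val_injective)
    (List.mem_finRange u)

theorem lookup_edgeCircuit (code : CSPCode X b) {e : Fin n × Fin n} (he : e ∈ code.edges) :
    Dat.lookup (.ofList (code.edges.map fun e : Fin n × Fin n =>
      .cons (.cons (.ofNat (e.1 : ℕ)) (.ofNat (e.2 : ℕ))) (code.edgeCircuit e).toDat))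
      (.cons (.ofNat (e.1 : ℕ)) (.ofNat (e.2 : ℕ))) = (code.edgeCircuit e).toDat :=
  Dat.lookup_map code.edges
    (fun e : Fin n × Fin n => .cons (.ofNat (e.1 : ℕ)) (.ofNat (e.2 : ℕ)))
    (fun e => (code.edgeCircuit e).toDat)
    (fun e e' h => by
      simp only [Dat.cons.injEq, Dat.ofNat_inj] at h
      exact Prod.ext (Fin.ext h.1) (Fin.ext h.2)) he

theorem faceCircuit_toDat (code : CSPCode X b) (hedges : ∀ e, e ∈ code.edges ↔ e ∈ X.graph.edges)
    (A : X.Face k) :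
    Dat.faceCircuit k code.toDat.snd.snd.fst code.toDat.snd.snd.snd.fst (X.faceDat A) =
      (Circuit.all (faceChecks code.vertexCircuit code.edgeCircuit A)).toDat := by
  rw [← Dat.circuitAll_toDat, Dat.faceCircuit]
  simp only [toDat, Dat.ofList, Dat.snd_cons, Dat.fst_cons, faceDat_getD, Dat.toList_ofList,
    faceChecks, List.map_append, List.map_map, lookup_vertexCircuit]
  congr 2
  congr 1
  · refine List.map_congr_left fun p hp => ?_
    rw [lookup_edgeCircuit code (e := (X.vert A p.1, X.vert A p.2))
      ((hedges _).2 (vert_pair_mem_edges A (mem_positionPairs.1 hp)))]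
    refine Dat.circuitReindex_toDat _ _ _ (fun t ht => ?_) (fun t ht => ?_) _
    · obtain rfl : t = 0 := Fin.ext ht
      rfl
    · obtain rfl : t = 1 := Fin.ext (by have := t.2; simp; omega)
      rfl
  · congr 1 <;> exact List.map_congr_left fun p _ =>
      Dat.circuitReindex_toDat _ _ _ (fun _ _ => rfl) (fun _ _ => rfl) _

theorem labelCover_toDat (code : CSPCode X b)
    (hedges : ∀ e, e ∈ code.edges ↔ e ∈ X.graph.edges) (hk : 0 < k) (hs : 0 < s) :
    Dat.labelCover k s code.toDat = (code.labelCover hk hs).toDat := by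
  have h1 : code.toDat.snd.fst.toList = code.tops.map X.faceDat := by
    simp [toDat, Dat.ofList]
  rw [Dat.labelCover, h1, LabelCoverCode.toDat, labelCover]
  simp only [Dat.ofList, Dat.toList_ofList, List.flatMap_map, ← map_faceDat_subfaces hk,
    ← map_faceDat_subfaces hs, List.map_flatMap, List.map_map, Function.comp_def,
    faceCircuit_toDat code hedges]
  rfl

theorem nodup_chains (hk : 0 < k) (hs : 0 < s) (D : X.Face d) :
    ((subfaces hk D).flatMap fun A => (subfaces hs A).map fun B => (A, B)).Nodup := by
  rw [List.nodup_flatMap]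
  refine ⟨fun A _ => (nodup_subfaces hs A).map fun B B' h => (Prod.ext_iff.1 h).2, ?_⟩
  refine (nodup_subfaces hk D).imp_of_mem fun {A A'} _ _ hne => ?_
  simp only [Function.onFun, List.disjoint_left, List.mem_map, not_exists, not_and]
  rintro _ ⟨B, _, rfl⟩ B' _ h
  exact hne (Prod.ext_iff.1 h).1.symm

/-- Every top face above `A` contributes the chain `B ⊆ A` exactly once. Repetitions are kept in the
edge list so that frequencies become weights. -/
theorem count_edges_labelCover [DecidableEq (X.Face k × X.Face s)] (code : CSPCode X b) (hnd : code.tops.Nodup)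
    (hmem : ∀ D, D ∈ code.tops) (hk : 0 < k) (hs : 0 < s) (A : X.Face k) (B : X.Face s)
    (hBA : B.1 ⊆ A.1) : (code.labelCover hk hs).edges.count (A, B) = X.topDegree A.1 := by
  rw [labelCover, List.count_flatMap]
  have h1 : (List.count (A, B) ∘ fun D : X.Face d => (subfaces hk D).flatMap fun A =>
      (subfaces hs A).map fun B => (A, B)) = fun D => if A.1 ⊆ D.1 then 1 else 0 := by
    funext D
    rw [Function.comp_apply, (nodup_chains hk hs D).count]
    congr 1
    simp [mem_subfaces, hBA]
  have h2 : code.tops.toFinset = Finset.univ := by ext D; simp [hmem D]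
  rw [h1, ← List.sum_toFinset _ hnd, h2, topDegree, Finset.card_filter]

theorem length_edges_labelCover (code : CSPCode X b) (hnd : code.tops.Nodup)
    (hmem : ∀ D, D ∈ code.tops) (hk : 0 < k) (hs : 0 < s) :
    (code.labelCover hk hs).edges.length =
      Fintype.card (X.Face d) * (d.choose k * k.choose s) := by
  have h2 : code.tops.toFinset = Finset.univ := by ext D; simp [hmem D]
  have h3 : code.tops.length = Fintype.card (X.Face d) := by
    rw [← List.toFinset_card_of_nodup hnd, h2, Finset.card_univ]
  simp [labelCover, List.length_flatMap, length_subfaces, h3, List.map_const']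

end CSPCode

/-! ### Counting faces -/

theorem Finset.card_filter_superset_powersetCard {α : Type*} [DecidableEq α] {B D : Finset α}
    (hBD : B ⊆ D) {k : ℕ} (hk : B.card ≤ k) :
    ((D.powersetCard k).filter fun A => B ⊆ A).card =
      (D.card - B.card).choose (k - B.card) := by
  rw [← Finset.card_sdiff_of_subset hBD, ← Finset.card_powersetCard]
  refine Finset.card_nbij' (fun A => A \ B) (fun S => B ∪ S) ?_ ?_ ?_ ?_
  · intro A hA
    simp only [Finset.coe_filter, Finset.mem_powersetCard, Set.mem_ofPred_eq] at hA
    simp only [Finset.mem_coe, Finset.mem_powersetCard]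
    exact ⟨Finset.sdiff_subset_sdiff hA.1.1 le_rfl,
      by rw [Finset.card_sdiff_of_subset hA.2, hA.1.2]⟩
  · intro S hS
    simp only [Finset.mem_coe, Finset.mem_powersetCard] at hS
    have hd : Disjoint B S :=
      Finset.disjoint_left.2 fun v hv hv' => (Finset.mem_sdiff.1 (hS.1 hv')).2 hv
    simp only [Finset.coe_filter, Finset.mem_powersetCard, Set.mem_ofPred_eq]
    refine ⟨⟨Finset.union_subset hBD (hS.1.trans Finset.sdiff_subset), ?_⟩,
      Finset.subset_union_left⟩
    rw [Finset.card_union_of_disjoint hd, hS.2]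
    omega
  · intro A hA
    simp only [Finset.coe_filter, Finset.mem_powersetCard, Set.mem_ofPred_eq] at hA
    exact Finset.union_sdiff_of_subset hA.2
  · intro S hS
    simp only [Finset.mem_coe, Finset.mem_powersetCard] at hS
    have hd : Disjoint B S :=
      Finset.disjoint_left.2 fun v hv hv' => (Finset.mem_sdiff.1 (hS.1 hv')).2 hv
    exact Finset.union_sdiff_cancel_left hd

namespace PureComplex

variable {n d : ℕ} {X : PureComplex n d} {k : ℕ}

theorem sum_faces_subset {M : Type*} [AddCommMonoid M] {m : ℕ} (hk : 0 < k) (D : X.Face m)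
    (φ : Finset (Fin n) → M) :
    ∑ A : X.Face k, (if A.1 ⊆ D.1 then φ A.1 else 0) = ∑ A ∈ D.1.powersetCard k, φ A := by
  rw [← Finset.sum_filter]
  refine Finset.sum_bij (fun A _ => A.1) ?_ ?_ ?_ ?_
  · intro A hA
    exact Finset.mem_powersetCard.2 ⟨(Finset.mem_filter.1 hA).2, A.2.2⟩
  · intro A _ A' _ h
    exact Subtype.ext h
  · intro A hA
    obtain ⟨h1, h2⟩ := Finset.mem_powersetCard.1 hA
    refine ⟨mkFace A ⟨X.mem_faces_of_subset D.2.1 h1 (Finset.card_pos.1 (by omega)), h2⟩, ?_, rfl⟩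
    exact Finset.mem_filter.2 ⟨Finset.mem_univ _, h1⟩
  · intro A _
    rfl

theorem card_between (hk : 0 < k) {B : Finset (Fin n)} (hB : B.card ≤ k) {D : X.Face d}
    (hBD : B ⊆ D.1) :
    (X.between k B D).card = (d - B.card).choose (k - B.card) := by
  have hD : D.1.card = d := D.2.2
  have h1 := Finset.card_filter_superset_powersetCard hBD hB
  rw [hD, Finset.card_filter, ← sum_faces_subset hk] at h1
  rw [← h1, between, Finset.card_filter]
  refine Finset.sum_congr rfl fun A _ => ?_
  by_cases h2 : B ⊆ A.1 <;> by_cases h3 : A.1 ⊆ D.1 <;> simp [h2, h3]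

/-- Double count the pairs `(A, D)` with `J ⊆ A ⊆ D`. -/
theorem sum_topDegree (hk : 0 < k) {J : Finset (Fin n)} (hJ : J.card ≤ k) :
    ∑ A : X.Face k, (if J ⊆ A.1 then X.topDegree A.1 else 0) =
      (d - J.card).choose (k - J.card) * X.topDegree J := by
  have h1 : ∀ A : X.Face k, (if J ⊆ A.1 then X.topDegree A.1 else 0) =
      ∑ D : X.Face d, if J ⊆ A.1 ∧ A.1 ⊆ D.1 then 1 else 0 := fun A => by
    by_cases h : J ⊆ A.1 <;> simp [h, topDegree]
  rw [Finset.sum_congr rfl fun A _ => h1 A, Finset.sum_comm, topDegree, Finset.card_filter,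
    Finset.mul_sum]
  refine Finset.sum_congr rfl fun D _ => ?_
  by_cases hJD : J ⊆ D.1
  · rw [if_pos hJD, mul_one, ← card_between hk hJ hJD, between, Finset.card_filter]
  · rw [if_neg hJD, mul_zero]
    refine Finset.sum_eq_zero fun A _ => if_neg fun h => hJD (h.1.trans h.2)

/-- The number of top faces that contain `I` and `u`, for `u` outside of `I`. -/
noncomputable def linkDegree (X : PureComplex n d) (I : Finset (Fin n)) (u : Fin n) : ℝ :=
  if u ∈ I then 0 else (X.topDegree (insert u I) : ℝ)

theorem linkDegree_nonneg (I : Finset (Fin n)) (u : Fin n) : 0 ≤ X.linkDegree I u := by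
  unfold linkDegree
  split <;> positivity

theorem sum_linkDegree (I : Finset (Fin n)) :
    ∑ u, X.linkDegree I u = ((d - I.card : ℕ) : ℝ) * X.topDegree I := by
  have h1 : ∀ u, X.linkDegree I u =
      ((∑ D : X.Face d, if I ⊆ D.1 ∧ u ∈ D.1 \ I then 1 else 0 : ℕ) : ℝ) := fun u => by
    unfold linkDegree topDegree
    split_ifs with hu
    · simp [hu]
    · rw [Finset.card_filter]
      simp [hu, Finset.insert_subset_iff, and_comm]
  rw [Finset.sum_congr rfl fun u _ => h1 u, ← Nat.cast_sum, Finset.sum_comm, topDegree,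
    Finset.card_filter, ← Nat.cast_mul, Finset.mul_sum]
  congr 1
  refine Finset.sum_congr rfl fun D _ => ?_
  by_cases hI : I ⊆ D.1
  · have hD : D.1.card = d := D.2.2
    simp only [hI, true_and, if_true, mul_one]
    rw [← Finset.card_filter, Finset.filter_mem_eq_inter, Finset.univ_inter,
      Finset.card_sdiff_of_subset hI, hD]
  · simp [hI]

/-- The edges at `u` in the link of `I` are the vertices of the link of `I ∪ {u}`, so
`sum_linkDegree` applies there. -/
theorem sum_linkWeight (I : Finset (Fin n)) (u : Fin n) :
    ∑ v, X.linkWeight I u v = ((d - I.card - 1 : ℕ) : ℝ) * X.linkDegree I u := by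
  by_cases hu : u ∈ I
  · simp [linkWeight, linkDegree, hu]
  · have h1 : ∀ v, X.linkWeight I u v = X.linkDegree (insert u I) v := fun v => by
      have h2 : I ∪ {u, v} = insert v (insert u I) := by
        ext w; simp only [Finset.mem_union, Finset.mem_insert, Finset.mem_singleton]; tauto
      by_cases hv : v ∈ I
      · simp [linkWeight, linkDegree, hv]
      · by_cases huv : v = u
        · simp [linkWeight, linkDegree, huv]
        · simp [linkWeight, linkDegree, hu, hv, huv, Ne.symm huv, h2]
    rw [Finset.sum_congr rfl fun v _ => h1 v, sum_linkDegree, Finset.card_insert_of_notMem hu,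
      linkDegree, if_neg hu, Nat.sub_sub]

/-! ### Sampling in links -/

/-- Averages over random `k`-faces above `I` concentrate: second moment in terms of the link. -/
theorem sum_sq_eq (I : Finset (Fin n)) (hk : I.card + 2 ≤ k) (g : Fin n → ℝ) :
    ∑ A : X.Face k, (if I ⊆ A.1 then (X.topDegree A.1 : ℝ) * (∑ u ∈ A.1 \ I, g u) ^ 2 else 0) =
      ((d - (I.card + 2)).choose (k - (I.card + 2)) : ℝ) *
          ∑ u, ∑ v, X.linkWeight I u v * g u * g v +
        ((d - (I.card + 1)).choose (k - (I.card + 1)) : ℝ) *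
          ∑ u, X.linkDegree I u * g u ^ 2 := by
  have h1 : ∀ A : X.Face k,
      (if I ⊆ A.1 then (X.topDegree A.1 : ℝ) * (∑ u ∈ A.1 \ I, g u) ^ 2 else 0) =
      ∑ u, ∑ v, (if I ⊆ A.1 ∧ u ∈ A.1 \ I ∧ v ∈ A.1 \ I then (X.topDegree A.1 : ℝ) else 0) *
        (g u * g v) := fun A => by
    by_cases hI : I ⊆ A.1
    · have h2 : ∑ u ∈ A.1 \ I, g u = ∑ u, if u ∈ A.1 \ I then g u else 0 := by
        rw [← Finset.sum_filter, Finset.filter_mem_eq_inter, Finset.univ_inter]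
      rw [if_pos hI, h2, sq, Finset.sum_mul_sum, Finset.mul_sum]
      refine Finset.sum_congr rfl fun u _ => ?_
      rw [Finset.mul_sum]
      refine Finset.sum_congr rfl fun v _ => ?_
      by_cases hu : u ∈ A.1 \ I <;> by_cases hv : v ∈ A.1 \ I <;> simp only [hI, hu, hv] <;> simp
    · simp [hI]
  have h3 : ∀ J : Finset (Fin n), J.card ≤ k →
      ∑ A : X.Face k, (if J ⊆ A.1 then (X.topDegree A.1 : ℝ) else 0) =
      ((d - J.card).choose (k - J.card) : ℝ) * X.topDegree J := fun J hJ => by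
    have := sum_topDegree (X := X) (k := k) (by omega) hJ
    exact_mod_cast this
  -- The set `I ∪ {u, v}` has `|I| + 2` elements off the diagonal and `|I| + 1` on it; this
  -- separates the quadratic form of the link graph from the sum of squares.
  have h4 : ∀ u v, ∑ A : X.Face k,
      (if I ⊆ A.1 ∧ u ∈ A.1 \ I ∧ v ∈ A.1 \ I then (X.topDegree A.1 : ℝ) else 0) =
      ((d - (I.card + 2)).choose (k - (I.card + 2)) : ℝ) * X.linkWeight I u v +
        if u = v then ((d - (I.card + 1)).choose (k - (I.card + 1)) : ℝ) * X.linkDegree I u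
          else 0 := fun u v => by
    by_cases hu : u ∈ I
    · simp [linkWeight, linkDegree, hu]
    by_cases hv : v ∈ I
    · have : u ≠ v := fun h => hu (h ▸ hv)
      simp [linkWeight, hv, this]
    by_cases huv : u = v
    · subst huv
      have h5 := h3 (insert u I) (by rw [Finset.card_insert_of_notMem hu]; omega)
      rw [Finset.card_insert_of_notMem hu] at h5
      simp only [linkWeight, ne_eq, not_true_eq_false, false_and, if_false, mul_zero, if_true,
        zero_add, linkDegree, hu, ← h5]
      refine Finset.sum_congr rfl fun A _ => if_congr ?_ rfl rfl
      simp [Finset.insert_subset_iff, hu, and_comm]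
    · have hu' : u ∉ insert v I := by simp [huv, hu]
      have h5 := h3 (insert u (insert v I)) (by
        rw [Finset.card_insert_of_notMem hu', Finset.card_insert_of_notMem hv]; omega)
      have h6 : I ∪ {u, v} = insert u (insert v I) := by
        ext w; simp only [Finset.mem_union, Finset.mem_insert, Finset.mem_singleton]; tauto
      rw [Finset.card_insert_of_notMem hu', Finset.card_insert_of_notMem hv] at h5
      simp only [linkWeight, ne_eq, huv, not_false_eq_true, hu, hv, and_self, if_true, if_false,
        add_zero, h6, ← h5]
      refine Finset.sum_congr rfl fun A _ => if_congr ?_ rfl rfl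
      simp only [Finset.insert_subset_iff, Finset.mem_sdiff, hu, hv, not_false_eq_true, and_true]
      tauto
  rw [Finset.sum_congr rfl fun A _ => h1 A, Finset.sum_comm, Finset.mul_sum, Finset.mul_sum,
    ← Finset.sum_add_distrib]
  refine Finset.sum_congr rfl fun u _ => ?_
  have h7 : ∀ v, ∑ A : X.Face k,
      (if I ⊆ A.1 ∧ u ∈ A.1 \ I ∧ v ∈ A.1 \ I then (X.topDegree A.1 : ℝ) else 0) * (g u * g v) =
      ((d - (I.card + 2)).choose (k - (I.card + 2)) : ℝ) * (X.linkWeight I u v * g u * g v) +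
        if u = v then ((d - (I.card + 1)).choose (k - (I.card + 1)) : ℝ) *
          (X.linkDegree I u * g u ^ 2) else 0 := fun v => by
    rw [← Finset.sum_mul, h4]
    split_ifs with h
    · subst h; ring
    · ring
  rw [Finset.sum_comm, Finset.sum_congr rfl fun v _ => h7 v, Finset.sum_add_distrib,
    Finset.sum_ite_eq, if_pos (Finset.mem_univ _), Finset.mul_sum]

theorem choose_mul_link {i : ℕ} (hk : i < k) (hkd : k ≤ d) :
    ((d - (i + 1)).choose (k - (i + 1)) : ℝ) * ((d - i : ℕ) : ℝ) =
      ((d - i).choose (k - i) : ℝ) * ((k - i : ℕ) : ℝ) := by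
  obtain ⟨a, rfl⟩ : ∃ a, d = i + 1 + a := ⟨d - (i + 1), by omega⟩
  obtain ⟨b, rfl⟩ : ∃ b, k = i + 1 + b := ⟨k - (i + 1), by omega⟩
  have h1 : i + 1 + a - i = a + 1 := by omega
  have h2 : i + 1 + b - i = b + 1 := by omega
  rw [Nat.add_sub_cancel_left, Nat.add_sub_cancel_left, h1, h2]
  have := Nat.add_one_mul_choose_eq a b
  rw [mul_comm]
  exact_mod_cast this

/-- The second moment of the centred function is a quadratic form of the link graph plus a diagonal
term. The spectral bound makes the former at most the latter, hence the factor `2`, and the latter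
is at most its value for `g = 1`. -/
theorem sum_sq_sub_mean_le {γ : ℝ} (hX : X.IsLocalSpectralExpander γ) (hγ : 0 ≤ γ)
    {I : Finset (Fin n)} (hI : I = ∅ ∨ I ∈ X.faces) (hk : I.card + 2 ≤ k) (hkd : k ≤ d)
    (hγk : γ * k ≤ 1) (g : Fin n → ℝ) (hg0 : ∀ u, 0 ≤ g u) (hg1 : ∀ u, g u ≤ 1) (μ : ℝ)
    (hμ : ∑ u, X.linkDegree I u * g u = μ * (((d - I.card : ℕ) : ℝ) * X.topDegree I)) :
    ∑ A : X.Face k, (if I ⊆ A.1 then (X.topDegree A.1 : ℝ) *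
        (∑ u ∈ A.1 \ I, g u - ((k - I.card : ℕ) : ℝ) * μ) ^ 2 else 0) ≤
      2 * ((k - I.card : ℕ) : ℝ) * ((d - I.card).choose (k - I.card) : ℝ) * X.topDegree I := by
  set N1 : ℝ := ((d - (I.card + 1)).choose (k - (I.card + 1)) : ℝ) with hN1
  set N2 : ℝ := ((d - (I.card + 2)).choose (k - (I.card + 2)) : ℝ) with hN2
  have hN1' : 0 ≤ N1 := Nat.cast_nonneg _
  have hN2' : 0 ≤ N2 := Nat.cast_nonneg _
  rw [← sum_linkDegree] at hμ
  have h1 : ∀ A : X.Face k, (if I ⊆ A.1 then (X.topDegree A.1 : ℝ) *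
        (∑ u ∈ A.1 \ I, g u - ((k - I.card : ℕ) : ℝ) * μ) ^ 2 else 0) =
      if I ⊆ A.1 then (X.topDegree A.1 : ℝ) * (∑ u ∈ A.1 \ I, (g u - μ)) ^ 2 else 0 := fun A => by
    by_cases h : I ⊆ A.1
    · have hA : A.1.card = k := A.2.2
      rw [if_pos h, if_pos h, Finset.sum_sub_distrib, Finset.sum_const,
        Finset.card_sdiff_of_subset h, hA, nsmul_eq_mul]
    · rw [if_neg h, if_neg h]
  rw [Finset.sum_congr rfl fun A _ => h1 A, sum_sq_eq I hk]
  have hd1 : (d - I.card - 1 : ℕ) = d - (I.card + 1) := by omega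
  -- By the choice of `μ` the function `g - μ` is orthogonal to the constants.
  have h2 := hX I hI (by omega) (fun u => g u - μ) (by
    simp only [sum_linkWeight, mul_assoc, ← Finset.mul_sum, mul_sub, Finset.sum_sub_distrib,
      ← Finset.sum_mul, hμ]
    ring)
  simp only [sum_linkWeight, mul_assoc, ← Finset.mul_sum] at h2
  simp only [mul_assoc] at h2 ⊢
  have h3 : ∑ u, X.linkDegree I u * (g u - μ) ^ 2 ≤ ∑ u, X.linkDegree I u := by
    have h4 : ∑ u, X.linkDegree I u * (g u - μ) ^ 2 =
        ∑ u, X.linkDegree I u * g u ^ 2 - μ ^ 2 * ∑ u, X.linkDegree I u := by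
      have h5 : ∀ u, X.linkDegree I u * (g u - μ) ^ 2 = X.linkDegree I u * g u ^ 2 -
          2 * μ * (X.linkDegree I u * g u) + μ ^ 2 * X.linkDegree I u := fun u => by ring
      simp only [h5, Finset.sum_add_distrib, Finset.sum_sub_distrib, ← Finset.mul_sum, hμ]
      ring
    have h6 : ∑ u, X.linkDegree I u * g u ^ 2 ≤ ∑ u, X.linkDegree I u :=
      Finset.sum_le_sum fun u _ => mul_le_of_le_one_right (linkDegree_nonneg I u)
        (pow_le_one₀ (hg0 u) (hg1 u))
    have h7 : 0 ≤ μ ^ 2 * ∑ u, X.linkDegree I u :=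
      mul_nonneg (sq_nonneg _) (Finset.sum_nonneg fun u _ => linkDegree_nonneg I u)
    linarith
  set Q := ∑ u, X.linkDegree I u * (g u - μ) ^ 2 with hQ
  have hQ0 : 0 ≤ Q :=
    Finset.sum_nonneg fun u _ => mul_nonneg (linkDegree_nonneg I u) (sq_nonneg _)
  have h8 := choose_mul_link (i := I.card) (k := k) (d := d) (by omega) hkd
  have h9 := choose_mul_link (i := I.card + 1) (k := k) (d := d) (by omega) hkd
  rw [← hN1] at h8 h9
  rw [show I.card + 1 + 1 = I.card + 2 from rfl, ← hN2] at h9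
  rw [sum_linkDegree] at h3
  rw [hd1] at h2
  -- By `h9` the off-diagonal term is `γ (k - |I| - 1)` times the diagonal one, and `γ k ≤ 1`.
  have h10 : N2 * (γ * (((d - (I.card + 1) : ℕ) : ℝ) * Q)) ≤ N1 * Q := by
    have h11 : γ * ((k - (I.card + 1) : ℕ) : ℝ) ≤ 1 :=
      (mul_le_mul_of_nonneg_left (Nat.cast_le.2 (by omega)) hγ).trans hγk
    calc N2 * (γ * (((d - (I.card + 1) : ℕ) : ℝ) * Q))
        = (γ * ((k - (I.card + 1) : ℕ) : ℝ)) * (N1 * Q) := by linear_combination γ * Q * h9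
      _ ≤ 1 * (N1 * Q) := mul_le_mul_of_nonneg_right h11 (mul_nonneg hN1' hQ0)
      _ = N1 * Q := one_mul _
  have h12 := mul_le_mul_of_nonneg_left h2 hN2'
  have h13 := mul_le_mul_of_nonneg_left h3 hN1'
  have h14 : N1 * (((d - I.card : ℕ) : ℝ) * X.topDegree I) =
      ((k - I.card : ℕ) : ℝ) * (((d - I.card).choose (k - I.card) : ℝ) * X.topDegree I) := by
    linear_combination (X.topDegree I : ℝ) * h8
  linarith

end PureComplex

namespace PureComplex

variable {n d : ℕ} {X : PureComplex n d} {k s : ℕ}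

/-! ### Sampling pairs of vertices -/

theorem exists_linkDegree_mean (I : Finset (Fin n)) (g : Fin n → ℝ) (hg0 : ∀ u, 0 ≤ g u)
    (hg1 : ∀ u, g u ≤ 1) : ∃ μ : ℝ, 0 ≤ μ ∧ μ ≤ 1 ∧
      ∑ u, X.linkDegree I u * g u = μ * (((d - I.card : ℕ) : ℝ) * X.topDegree I) := by
  rw [← sum_linkDegree]
  have h0 : 0 ≤ ∑ u, X.linkDegree I u := Finset.sum_nonneg fun u _ => linkDegree_nonneg I u
  have h1 : 0 ≤ ∑ u, X.linkDegree I u * g u :=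
    Finset.sum_nonneg fun u _ => mul_nonneg (linkDegree_nonneg I u) (hg0 u)
  have h2 : ∑ u, X.linkDegree I u * g u ≤ ∑ u, X.linkDegree I u :=
    Finset.sum_le_sum fun u _ => mul_le_of_le_one_right (linkDegree_nonneg I u) (hg1 u)
  -- If the total degree is zero the quotient is `0` by convention, and the numerator vanishes too.
  refine ⟨(∑ u, X.linkDegree I u * g u) / ∑ u, X.linkDegree I u, div_nonneg h1 h0,
    div_le_one_of_le₀ h2 h0, ?_⟩
  rcases h0.eq_or_lt with h | h
  · rw [← h] at h2 ⊢
    rw [mul_zero]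
    exact le_antisymm h2 h1
  · rw [div_mul_cancel₀ _ h.ne']

/-- Two rounds of sampling: for each `v ∈ A` the sum over `u` is close to `(k-1) H v`, with `H v`
the mean over the link of `v`, and then the sum of `H` over `A` is close to `k ε`. -/
theorem sum_pairs_sq_sub_mean_le {γ : ℝ} (hX : X.IsLocalSpectralExpander γ) (hγ : 0 ≤ γ)
    (hk : 3 ≤ k) (hkd : k ≤ d) (hγk : γ * k ≤ 1) (h : Fin n → Fin n → ℝ)
    (h0 : ∀ v u, 0 ≤ h v u) (h1 : ∀ v u, h v u ≤ 1) (ε : ℝ)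
    (hε : ∑ v, ∑ u, X.linkDegree {v} u * h v u =
      ε * ((d : ℝ) * (((d - 1 : ℕ) : ℝ) * X.topDegree ∅))) :
    ∑ A : X.Face k, (X.topDegree A.1 : ℝ) *
        (∑ v ∈ A.1, ∑ u ∈ A.1 \ {v}, h v u - (k : ℝ) * ((k - 1 : ℕ) : ℝ) * ε) ^ 2 ≤
      8 * (k : ℝ) ^ 2 * ((k - 1 : ℕ) : ℝ) * ((d.choose k : ℝ) * X.topDegree ∅) := by
  choose H hH0 hH1 hH using fun v => exists_linkDegree_mean (X := X) {v} (h v) (h0 v) (h1 v)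
  simp only [Finset.card_singleton] at hH
  have hempty : ∀ v, X.linkDegree ∅ v = X.topDegree {v} := fun v => by simp [linkDegree]
  have hd1 : (0 : ℝ) < ((d - 1 : ℕ) : ℝ) := Nat.cast_pos.2 (by omega)
  have hHε : ∑ v, X.linkDegree ∅ v * H v =
      ε * (((d - (∅ : Finset (Fin n)).card : ℕ) : ℝ) * X.topDegree ∅) := by
    apply mul_left_cancel₀ hd1.ne'
    rw [Finset.card_empty, Nat.sub_zero]
    have : ∀ v, ∑ u, X.linkDegree {v} u * h v u =
        ((d - 1 : ℕ) : ℝ) * (X.linkDegree ∅ v * H v) := fun v => by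
      rw [hH, hempty]; ring
    rw [Finset.sum_congr rfl fun v _ => this v, ← Finset.mul_sum] at hε
    rw [hε]; ring
  have hvert := fun v => sum_sq_sub_mean_le hX hγ (I := {v}) (Or.inr (X.singleton_mem v))
    (k := k) (by simpa using hk) hkd hγk (h v) (h0 v) (h1 v) (H v)
    (by simpa only [Finset.card_singleton] using hH v)
  have hroot := sum_sq_sub_mean_le hX hγ (I := ∅) (Or.inl rfl)
    (k := k) (by simp; omega) hkd hγk H hH0 hH1 ε hHε
  simp only [Finset.card_singleton, Finset.singleton_subset_iff] at hvert
  simp only [Finset.card_empty, Nat.sub_zero, Finset.empty_subset, if_true,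
    Finset.sdiff_empty] at hroot
  have hsum := sum_linkDegree (X := X) ∅
  simp only [Finset.card_empty, Nat.sub_zero, hempty] at hsum
  have hchoose := choose_mul_link (i := 0) (k := k) (d := d) (by omega) hkd
  simp only [zero_add, Nat.sub_zero] at hchoose
  set N0 : ℝ := (d.choose k : ℝ) * X.topDegree ∅ with hN0
  have hfirst : ∑ A : X.Face k, (X.topDegree A.1 : ℝ) * ((k : ℝ) * ∑ v ∈ A.1,
        (∑ u ∈ A.1 \ {v}, h v u - ((k - 1 : ℕ) : ℝ) * H v) ^ 2) ≤
      2 * (k : ℝ) ^ 2 * ((k - 1 : ℕ) : ℝ) * N0 := by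
    have e1 : ∀ A : X.Face k, (X.topDegree A.1 : ℝ) * ((k : ℝ) * ∑ v ∈ A.1,
        (∑ u ∈ A.1 \ {v}, h v u - ((k - 1 : ℕ) : ℝ) * H v) ^ 2) =
        ∑ v, (k : ℝ) * if v ∈ A.1 then (X.topDegree A.1 : ℝ) *
          (∑ u ∈ A.1 \ {v}, h v u - ((k - 1 : ℕ) : ℝ) * H v) ^ 2 else 0 := fun A => by
      rw [← Finset.mul_sum, ← Finset.sum_filter, Finset.filter_mem_eq_inter, Finset.univ_inter,
        ← Finset.mul_sum]
      ring
    rw [Finset.sum_congr rfl fun A _ => e1 A, Finset.sum_comm]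
    simp only [← Finset.mul_sum]
    calc (k : ℝ) * ∑ v, ∑ A : X.Face k, (if v ∈ A.1 then (X.topDegree A.1 : ℝ) *
          (∑ u ∈ A.1 \ {v}, h v u - ((k - 1 : ℕ) : ℝ) * H v) ^ 2 else 0)
        ≤ (k : ℝ) * ∑ v, 2 * ((k - 1 : ℕ) : ℝ) * ((d - 1).choose (k - 1) : ℝ) *
            X.topDegree {v} :=
          mul_le_mul_of_nonneg_left (Finset.sum_le_sum fun v _ => hvert v) (Nat.cast_nonneg _)
      _ = 2 * (k : ℝ) ^ 2 * ((k - 1 : ℕ) : ℝ) * N0 := by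
          rw [← Finset.mul_sum, hsum, hN0]
          linear_combination 2 * (k : ℝ) * ((k - 1 : ℕ) : ℝ) * (X.topDegree ∅ : ℝ) * hchoose
  have hkk : ((k - 1 : ℕ) : ℝ) ≤ k := Nat.cast_le.2 (by omega)
  have hk0 : (0 : ℝ) ≤ ((k - 1 : ℕ) : ℝ) := Nat.cast_nonneg _
  have hN0' : 0 ≤ N0 := by positivity
  calc ∑ A : X.Face k, (X.topDegree A.1 : ℝ) *
        (∑ v ∈ A.1, ∑ u ∈ A.1 \ {v}, h v u - (k : ℝ) * ((k - 1 : ℕ) : ℝ) * ε) ^ 2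
      ≤ ∑ A : X.Face k, (2 * ((X.topDegree A.1 : ℝ) * ((k : ℝ) * ∑ v ∈ A.1,
          (∑ u ∈ A.1 \ {v}, h v u - ((k - 1 : ℕ) : ℝ) * H v) ^ 2)) +
        2 * ((k - 1 : ℕ) : ℝ) ^ 2 * ((X.topDegree A.1 : ℝ) *
          (∑ v ∈ A.1, H v - (k : ℝ) * ε) ^ 2)) := by
        refine Finset.sum_le_sum fun A _ => ?_
        have hA : A.1.card = k := A.2.2
        have e1 := sq_sum_le_card_mul_sum_sq (s := A.1)
          (f := fun v => ∑ u ∈ A.1 \ {v}, h v u - ((k - 1 : ℕ) : ℝ) * H v)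
        rw [hA, Finset.sum_sub_distrib, ← Finset.mul_sum] at e1
        set P := ∑ v ∈ A.1, ∑ u ∈ A.1 \ {v}, h v u
        set R := ∑ v ∈ A.1, H v
        -- `(a + b)² ≤ 2a² + 2b²`, with `a` the error in the links of the vertices and `b` the error
        -- at the empty face.
        have e2 : (P - (k : ℝ) * ((k - 1 : ℕ) : ℝ) * ε) ^ 2 ≤
            2 * (P - ((k - 1 : ℕ) : ℝ) * R) ^ 2 +
              2 * ((k - 1 : ℕ) : ℝ) ^ 2 * (R - (k : ℝ) * ε) ^ 2 := by
          nlinarith [sq_nonneg ((P - ((k - 1 : ℕ) : ℝ) * R) -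
            ((k - 1 : ℕ) : ℝ) * (R - (k : ℝ) * ε))]
        have e3 : (0 : ℝ) ≤ X.topDegree A.1 := Nat.cast_nonneg _
        have e4 := mul_le_mul_of_nonneg_left
          (e2.trans (add_le_add (mul_le_mul_of_nonneg_left e1 zero_le_two) le_rfl)) e3
        refine e4.trans (le_of_eq ?_)
        ring
    _ ≤ 2 * (2 * (k : ℝ) ^ 2 * ((k - 1 : ℕ) : ℝ) * N0) +
        2 * ((k - 1 : ℕ) : ℝ) ^ 2 * (2 * k * N0) := by
        rw [Finset.sum_add_distrib, ← Finset.mul_sum, ← Finset.mul_sum]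
        refine add_le_add (mul_le_mul_of_nonneg_left hfirst zero_le_two)
          (mul_le_mul_of_nonneg_left (hroot.trans (le_of_eq ?_)) (by positivity))
        rw [hN0]; ring
    _ ≤ 8 * (k : ℝ) ^ 2 * ((k - 1 : ℕ) : ℝ) * N0 := by
        have e1 : ((k - 1 : ℕ) : ℝ) * (((k - 1 : ℕ) : ℝ) * ((k : ℝ) * N0)) ≤
            k * (((k - 1 : ℕ) : ℝ) * ((k : ℝ) * N0)) :=
          mul_le_mul_of_nonneg_right hkk (by positivity)
        nlinarith

/-! ### The acceptance probability of the direct product test -/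

end PureComplex

theorem Finset.expect_sq_le {ι : Type*} (t : Finset ι) (f : ι → ℝ) :
    (Finset.expect t f) ^ 2 ≤ Finset.expect t fun i => f i ^ 2 := by
  rw [Finset.expect_eq_sum_div_card, Finset.expect_eq_sum_div_card]
  rcases t.eq_empty_or_nonempty with rfl | ht
  · simp
  · have h1 : (0 : ℝ) < t.card := Nat.cast_pos.2 ht.card_pos
    rw [div_pow, sq (t.card : ℝ), ← div_div]
    refine div_le_div_of_nonneg_right ?_ h1.le
    rw [div_le_iff₀ h1, mul_comm]
    exact sq_sum_le_card_mul_sum_sq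

namespace PureComplex

variable {n d : ℕ} {X : PureComplex n d} {k s : ℕ}

theorem topDegree_empty : X.topDegree ∅ = Fintype.card (X.Face d) := by
  simp [topDegree, Finset.card_univ]

theorem exists_top_of_mem_faces {A : Finset (Fin n)} (hA : A ∈ X.faces) :
    ∃ D : X.Face d, A ⊆ D.1 := by
  obtain ⟨D, hD, h1, h2⟩ := X.pure A hA
  exact ⟨mkFace D ⟨hD, h2⟩, h1⟩

theorem topDegree_pos {A : Finset (Fin n)} (hA : A ∈ X.faces) : 0 < X.topDegree A := by
  obtain ⟨D, hD⟩ := exists_top_of_mem_faces hA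
  exact Finset.card_pos.2 ⟨D, Finset.mem_filter.2 ⟨Finset.mem_univ _, hD⟩⟩

theorem card_top_pos : 0 < Fintype.card (X.Face d) := by
  obtain ⟨A, hA⟩ := X.nonempty
  obtain ⟨D, -⟩ := exists_top_of_mem_faces hA
  exact Fintype.card_pos_iff.2 ⟨D⟩

theorem mu_nonneg (i : ℕ) (A : Finset (Fin n)) : 0 ≤ X.mu i A := by
  unfold mu; positivity

theorem sum_mu (hk : 0 < k) (hkd : k ≤ d) : ∑ A : X.Face k, X.mu k A.1 = 1 := by
  have h1 := sum_topDegree (X := X) (k := k) hk (J := ∅) (by simp)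
  simp only [Finset.empty_subset, if_true, Finset.card_empty, Nat.sub_zero, topDegree_empty] at h1
  have h2 : (0 : ℝ) < Fintype.card (X.Face d) := Nat.cast_pos.2 card_top_pos
  have h3 : (0 : ℝ) < d.choose k := Nat.cast_pos.2 (Nat.choose_pos hkd)
  have h4 : ∑ A : X.Face k, (X.topDegree A.1 : ℝ) = d.choose k * Fintype.card (X.Face d) := by
    exact_mod_cast h1
  simp only [mu, ← Finset.sum_div, h4]
  rw [mul_comm, div_self (by positivity)]

/-- Choosing first `D`, then `B`, then `A` between them is the same as choosing `A ∼ μ_k` and then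
`B ⊆ A`. -/
theorem expect_between (hk : 0 < k) (hsk : s ≤ k)
    (g : X.Face k → Finset (Fin n) → ℝ) :
    (Finset.expect Finset.univ fun D : X.Face d => Finset.expect (D.1.powersetCard s) fun B =>
        Finset.expect (X.between k B D) fun A => g A B) =
      ∑ A : X.Face k, ∑ B ∈ A.1.powersetCard s, X.mu k A.1 / (k.choose s : ℝ) * g A B := by
  have h1 : ∀ D : X.Face d, (Finset.expect (D.1.powersetCard s) fun B =>
      Finset.expect (X.between k B D) fun A => g A B) =
      ∑ A : X.Face k, ∑ B ∈ A.1.powersetCard s,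
        (if A.1 ⊆ D.1 then 1 else 0) * (g A B / ((d.choose s : ℝ) *
          ((d - s).choose (k - s) : ℝ))) := fun D => by
    have hD : D.1.card = d := D.2.2
    have h2 : ∀ B ∈ D.1.powersetCard s, (Finset.expect (X.between k B D) fun A => g A B) =
        ∑ A : X.Face k, if B ⊆ A.1 ∧ A.1 ⊆ D.1 then g A B / ((d - s).choose (k - s) : ℝ) else 0 :=
      fun B hB => by
        obtain ⟨h3, h4⟩ := Finset.mem_powersetCard.1 hB
        rw [Finset.expect_eq_sum_div_card, card_between hk (by omega) h3, h4, between,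
          Finset.sum_filter, Finset.sum_div]
        refine Finset.sum_congr rfl fun A _ => ?_
        split_ifs <;> simp
    rw [Finset.expect_eq_sum_div_card, Finset.card_powersetCard, hD, Finset.sum_congr rfl h2,
      Finset.sum_comm, Finset.sum_div]
    refine Finset.sum_congr rfl fun A _ => ?_
    by_cases hA : A.1 ⊆ D.1
    · simp only [hA, and_true, if_true, one_mul]
      rw [← Finset.sum_filter, Finset.sum_div]
      refine Finset.sum_congr ?_ fun B _ => by rw [div_div, mul_comm]
      ext B
      simp only [Finset.mem_filter, Finset.mem_powersetCard]
      exact ⟨fun h => ⟨h.2, h.1.2⟩, fun h => ⟨⟨h.1.trans hA, h.2⟩, h.1⟩⟩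
    · simp [hA]
  rw [Finset.expect_congr rfl fun D _ => h1 D, Finset.expect_eq_sum_div_card, Finset.sum_comm,
    Finset.sum_div]
  refine Finset.sum_congr rfl fun A _ => ?_
  rw [Finset.sum_comm, Finset.sum_div]
  refine Finset.sum_congr rfl fun B _ => ?_
  have h5 : ∑ D : X.Face d, (if A.1 ⊆ D.1 then (1 : ℝ) else 0) = X.topDegree A.1 := by
    rw [topDegree, Finset.card_filter]; push_cast; rfl
  -- Choosing `A ⊆ D` and then `B ⊆ A` amounts to choosing `B ⊆ D` and then `A` between them.
  have h6 : (d.choose k : ℝ) * k.choose s = d.choose s * (d - s).choose (k - s) := by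
    exact_mod_cast Nat.choose_mul hsk
  rw [← Finset.sum_mul, h5, mu, ← h6, Finset.card_univ]
  field_simp

/-- Given `D` and `B`, the faces `A`, `A'` are independent, so the square of the conditional
probability of `G` is the probability that both satisfy `G`, and in that case they agree. Averaging
over `D` and `B` only loses by convexity of the square. -/
theorem sq_le_passProb (hk : 0 < k) (hsk : s ≤ k) {Sig : Type}
    (F : X.Face k → Fin k → Sig) (G : X.Face k → Finset (Fin n) → Prop)
    [∀ A B, Decidable (G A B)] (hG : ∀ A A' B, G A B → G A' B → X.Agree F B A A') :
    (∑ A : X.Face k, ∑ B ∈ A.1.powersetCard s,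
        X.mu k A.1 / (k.choose s : ℝ) * (if G A B then 1 else 0)) ^ 2 ≤ X.passProb s F := by
  rw [← expect_between hk hsk fun A B => if G A B then 1 else 0]
  refine (Finset.expect_sq_le _ _).trans ?_
  refine Finset.expect_le_expect fun D _ => (Finset.expect_sq_le _ _).trans ?_
  refine Finset.expect_le_expect fun B _ => ?_
  rw [sq, Finset.expect_mul]
  refine Finset.expect_le_expect fun A _ => ?_
  rw [Finset.mul_expect]
  refine Finset.expect_le_expect fun A' _ => ?_
  by_cases h1 : G A B <;> by_cases h2 : G A' B
  · simp [h1, h2, hG A A' B h1 h2]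
  all_goals
    simp only [h1, h2, if_true, if_false, mul_zero, zero_mul]
    split <;> norm_num

end PureComplex

/-! ### Faces with private symbols -/

theorem Nat.le_choose_of_lt {d k : ℕ} (hk : 0 < k) (hkd : k < d) : d ≤ d.choose k := by
  induction d generalizing k with
  | zero => omega
  | succ d ih =>
    obtain ⟨k, rfl⟩ : ∃ j, k = j + 1 := ⟨k - 1, by omega⟩
    rw [Nat.choose_succ_succ]
    rcases Nat.lt_or_ge (k + 1) d with h | h
    · have h1 := ih (Nat.succ_pos k) h
      have h2 := Nat.choose_pos (n := d) (k := k) (by omega)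
      simp only [Nat.succ_eq_add_one] at *
      omega
    · obtain rfl : d = k + 1 := by omega
      rw [Nat.choose_self, Nat.choose_succ_self_right]

namespace PureComplex

variable {n d : ℕ} {X : PureComplex n d} {k s : ℕ}

theorem sum_vert {M : Type*} [AddCommMonoid M] (A : X.Face k) (φ : Fin n → M) :
    ∑ v ∈ A.1, φ v = ∑ i, φ (X.vert A i) := by
  have h1 : A.1 = Finset.univ.map (X.vert A).toEmbedding :=
    (Finset.map_orderEmbOfFin_univ A.1 A.2.2).symm
  rw [h1, Finset.sum_map]
  rfl

/-- If every face gets its own symbol then a fixed labelling is close to the constant labellings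
of few faces only. -/
theorem sum_mu_close_const_le (hk : 0 < k) (hkd : k < d) {α : Type*} [DecidableEq α]
    (f : Fin n → α) (c : X.Face k → α) (hc : Function.Injective c) (T : Finset (X.Face k))
    (hT : ∀ A ∈ T, (hammingDist (fun _ : Fin k => c A) (fun i => f (X.vert A i)) : ℝ) / k ≤ 1 / 2) :
    ∑ A ∈ T, X.mu k A.1 ≤ 2 / k := by
  have hk0 : (0 : ℝ) < k := Nat.cast_pos.2 hk
  have h1 : ∀ A ∈ T, k ≤ 2 * ∑ v ∈ A.1, if f v = c A then 1 else 0 := fun A hA => by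
    have h2 := hT A hA
    rw [div_le_div_iff₀ hk0 two_pos, one_mul] at h2
    have h3 : hammingDist (fun _ : Fin k => c A) (fun i => f (X.vert A i)) * 2 ≤ k := by
      exact_mod_cast h2
    have h4 : (∑ v ∈ A.1, if f v = c A then 1 else 0) +
        hammingDist (fun _ : Fin k => c A) (fun i => f (X.vert A i)) = k := by
      rw [sum_vert A fun v => if f v = c A then 1 else 0, ← Finset.card_filter, hammingDist]
      simp only [ne_comm (a := c A)]
      rw [Finset.card_filter_add_card_filter_not]
      simp
    omega
  -- Inside one top face: each close face uses up at least `k/2` vertices, whence at most `2d/k`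
  -- close faces, while there are `d.choose k ≥ d` faces in all. The last inequality needs `k < d`.
  have h2 : ∀ D : X.Face d, k * (∑ A ∈ T, if A.1 ⊆ D.1 then 1 else 0) ≤ 2 * d.choose k :=
    fun D => by
      have hD : D.1.card = d := D.2.2
      calc k * (∑ A ∈ T, if A.1 ⊆ D.1 then 1 else 0)
          = ∑ A ∈ T, if A.1 ⊆ D.1 then k else 0 := by
            rw [Finset.mul_sum]
            simp only [mul_ite, mul_one, mul_zero]
        _ ≤ ∑ A ∈ T, 2 * ∑ v ∈ D.1, if f v = c A then 1 else 0 := by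
            refine Finset.sum_le_sum fun A hA => ?_
            split_ifs with h
            · exact (h1 A hA).trans (Nat.mul_le_mul_left _
                (Finset.sum_le_sum_of_subset h))
            · exact Nat.zero_le _
        _ = 2 * ∑ v ∈ D.1, ∑ A ∈ T, if f v = c A then 1 else 0 := by
            rw [← Finset.mul_sum, Finset.sum_comm]
        -- The vertex `v` has one symbol, which by injectivity belongs to at most one face.
        _ ≤ 2 * ∑ v ∈ D.1, 1 := by
            refine Nat.mul_le_mul_left _ (Finset.sum_le_sum fun v _ => ?_)
            rw [← Finset.card_filter, Finset.card_le_one]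
            intro A hA A' hA'
            exact hc ((Finset.mem_filter.1 hA).2.symm.trans (Finset.mem_filter.1 hA').2)
        _ ≤ 2 * d.choose k := by
            rw [Finset.sum_const, hD, smul_eq_mul, mul_one]
            exact Nat.mul_le_mul_left _ (Nat.le_choose_of_lt hk hkd)
  have h3 : k * ∑ A ∈ T, X.topDegree A.1 ≤ Fintype.card (X.Face d) * (2 * d.choose k) := by
    have h4 : ∑ A ∈ T, X.topDegree A.1 =
        ∑ D : X.Face d, ∑ A ∈ T, if A.1 ⊆ D.1 then 1 else 0 := by
      rw [Finset.sum_comm]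
      exact Finset.sum_congr rfl fun A _ => by rw [topDegree, Finset.card_filter]
    rw [h4, Finset.mul_sum]
    refine (Finset.sum_le_sum fun D _ => h2 D).trans ?_
    rw [Finset.sum_const, Finset.card_univ, smul_eq_mul]
  have h5 : (0 : ℝ) < Fintype.card (X.Face d) := Nat.cast_pos.2 card_top_pos
  have h6 : (0 : ℝ) < d.choose k := Nat.cast_pos.2 (Nat.choose_pos hkd.le)
  have h7 : (k : ℝ) * ∑ A ∈ T, (X.topDegree A.1 : ℝ) ≤
      Fintype.card (X.Face d) * (2 * d.choose k) := by exact_mod_cast h3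
  simp only [mu, ← Finset.sum_div]
  rw [div_le_div_iff₀ (by positivity) hk0]
  linarith

/-! ### Violated edges -/

open Classical in
/-- The indicator function of the edges `v < u` that `f` violates. -/
noncomputable def violation {Sig : Type} (Ψ : GenCSP X.graph Sig) (f : Fin n → Sig)
    (v u : Fin n) : ℝ :=
  if v < u ∧ ¬ Ψ.Satisfies f (v, u) then 1 else 0

theorem violation_nonneg {Sig : Type} (Ψ : GenCSP X.graph Sig) (f : Fin n → Sig) (v u : Fin n) :
    0 ≤ violation Ψ f v u := by
  unfold violation; split <;> norm_num

theorem violation_le_one {Sig : Type} (Ψ : GenCSP X.graph Sig) (f : Fin n → Sig) (v u : Fin n) :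
    violation Ψ f v u ≤ 1 := by
  unfold violation; split <;> norm_num

/-- A labelling that agrees with a satisfying labelling of `A` outside of few positions violates
few edges of `A`. -/
theorem sum_violation_le {Sig : Type} (Ψ : GenCSP X.graph Sig) (f : Fin n → Sig) (A : X.Face k)
    {σ : Fin k → Sig} (hσ : σ ∈ satisfyingLabels Ψ A) (S : Finset (Fin k))
    (hS : ∀ i, i ∉ S → σ i = f (X.vert A i)) :
    ∑ v ∈ A.1, ∑ u ∈ A.1 \ {v}, violation Ψ f v u ≤ (S.card : ℝ) * ((k - 1 : ℕ) : ℝ) := by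
  have h1 : ∀ v ∈ A.1, ∑ u ∈ A.1 \ {v}, violation Ψ f v u = ∑ u ∈ A.1, violation Ψ f v u :=
    fun v hv => by
      refine Finset.sum_subset Finset.sdiff_subset fun u hu hu' => ?_
      obtain rfl : u = v := by
        by_contra hne
        exact hu' (Finset.mem_sdiff.2 ⟨hu, by simpa using hne⟩)
      simp [violation]
  -- A violated edge has an end in `S`.
  have h2 : ∀ i j : Fin k, violation Ψ f (X.vert A i) (X.vert A j) ≤
      (if i < j ∧ i ∈ S then 1 else 0) + if i < j ∧ j ∈ S then 1 else 0 := fun i j => by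
    by_cases hij : i < j
    · by_cases hi : i ∈ S
      · refine (violation_le_one _ _ _ _).trans ?_
        simp only [hij, hi, and_self, if_true]
        split <;> norm_num
      by_cases hj : j ∈ S
      · refine (violation_le_one _ _ _ _).trans ?_
        simp [hij, hi, hj]
      · have h3 := hσ i j hij
        rw [hS i hi, hS j hj] at h3
        have h4 : Ψ.Satisfies f (X.vert A i, X.vert A j) := h3
        simp [violation, h4, hi, hj]
    · simp [violation, hij]
  rw [Finset.sum_congr rfl h1, sum_vert A]
  simp only [sum_vert A]
  calc ∑ i, ∑ j, violation Ψ f (X.vert A i) (X.vert A j)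
      ≤ ∑ i : Fin k, ∑ j : Fin k, ((if i < j ∧ i ∈ S then (1 : ℝ) else 0) +
          if i < j ∧ j ∈ S then 1 else 0) :=
        Finset.sum_le_sum fun i _ => Finset.sum_le_sum fun j _ => h2 i j
    -- Swapping the indices in the second term merges both into a count of the edges at each
    -- position in `S`, of which there are `k - 1`.
    _ = ∑ i : Fin k, ∑ j : Fin k, if i ∈ S then (if i ≠ j then (1 : ℝ) else 0) else 0 := by
        simp only [Finset.sum_add_distrib]
        rw [Finset.sum_comm (f := fun i j : Fin k => if i < j ∧ j ∈ S then (1 : ℝ) else 0),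
          ← Finset.sum_add_distrib]
        refine Finset.sum_congr rfl fun i _ => ?_
        rw [← Finset.sum_add_distrib]
        refine Finset.sum_congr rfl fun j _ => ?_
        by_cases hi : i ∈ S
        · rcases lt_trichotomy i j with h | h | h
          · simp [hi, h, h.ne, h.not_gt]
          · simp [h]
          · simp [hi, h, h.ne', h.not_gt]
        · simp [hi]
    _ = (S.card : ℝ) * ((k - 1 : ℕ) : ℝ) := by
        have h5 : ∀ i : Fin k, ∑ j : Fin k, (if i ∈ S then (if i ≠ j then (1 : ℝ) else 0) else 0) =
            if i ∈ S then ((k - 1 : ℕ) : ℝ) else 0 := fun i => by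
          split_ifs with hi
          · rw [Finset.sum_boole, Finset.filter_ne, Finset.card_erase_of_mem (Finset.mem_univ _)]
            simp
          · simp
        rw [Finset.sum_congr rfl fun i _ => h5 i, Finset.sum_ite_mem, Finset.univ_inter,
          Finset.sum_const, nsmul_eq_mul]

theorem linkDegree_singleton {v u : Fin n} (h : v < u) :
    X.linkDegree {v} u = X.topDegree {v, u} := by
  rw [linkDegree, if_neg (by simpa using h.ne'), Finset.pair_comm]

theorem topDegree_eq_zero {A : Finset (Fin n)} (hA : A.Nonempty) (h : A ∉ X.faces) :
    X.topDegree A = 0 := by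
  rw [topDegree, Finset.card_eq_zero, Finset.filter_eq_empty_iff]
  exact fun D _ hD => h (X.mem_faces_of_subset D.2.1 hD hA)

/-- The weight of a set of edges of `X`. -/
theorem sum_edges_weight (hd : 2 ≤ d) (p : Fin n × Fin n → Prop) [DecidablePred p] :
    (∑ e ∈ X.graph.edges, if p e then X.graph.weight e else 0) *
        ((d : ℝ) * (((d - 1 : ℕ) : ℝ) * X.topDegree ∅)) =
      2 * ∑ v, ∑ u, X.linkDegree {v} u * if v < u ∧ p (v, u) then 1 else 0 := by
  classical
  have h1 : ∀ v u, X.linkDegree {v} u * (if v < u ∧ p (v, u) then (1 : ℝ) else 0) =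
      if v < u ∧ ({v, u} : Finset (Fin n)) ∈ X.faces then
        (if p (v, u) then (X.topDegree {v, u} : ℝ) else 0) else 0 := fun v u => by
    by_cases h : v < u
    · rw [linkDegree_singleton h]
      by_cases hf : ({v, u} : Finset (Fin n)) ∈ X.faces
      · by_cases hp : p (v, u) <;> simp [h, hf, hp]
      · simp [hf, topDegree_eq_zero (Finset.insert_nonempty _ _) hf]
    · simp [h]
  have h2 : (d.choose 2 : ℝ) * 2 = d * ((d - 1 : ℕ) : ℝ) := by
    rw [Nat.choose_two_right]
    have := Nat.div_mul_cancel (Nat.even_mul_pred_self d).two_dvd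
    exact_mod_cast this
  have h3 : (0 : ℝ) < Fintype.card (X.Face d) := Nat.cast_pos.2 card_top_pos
  have h4 : (0 : ℝ) < d.choose 2 := Nat.cast_pos.2 (Nat.choose_pos hd)
  simp only [h1]
  have h5 : ∑ v, ∑ u, (if v < u ∧ ({v, u} : Finset (Fin n)) ∈ X.faces then
        (if p (v, u) then (X.topDegree {v, u} : ℝ) else 0) else 0) =
      ∑ e ∈ X.graph.edges, if p e then (X.topDegree {e.1, e.2} : ℝ) else 0 := by
    rw [← Fintype.sum_prod_type' (f := fun v u =>
      if v < u ∧ ({v, u} : Finset (Fin n)) ∈ X.faces then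
        (if p (v, u) then (X.topDegree {v, u} : ℝ) else 0) else 0), ← Finset.sum_filter]
    exact Finset.sum_congr (by ext e; simp [mem_graph_edges]) fun e _ => rfl
  rw [h5, topDegree_empty, ← mul_assoc (d : ℝ), ← h2, Finset.sum_mul, Finset.mul_sum]
  refine Finset.sum_congr rfl fun e _ => ?_
  by_cases hp : p e
  · rw [if_pos hp, if_pos hp]
    change X.mu 2 {e.1, e.2} * _ = _
    rw [mu]
    field_simp
  · simp [hp]

theorem sum_graph_weight (hd : 2 ≤ d) : ∑ e ∈ X.graph.edges, X.graph.weight e = 1 := by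
  have h1 := sum_edges_weight (X := X) hd fun _ => True
  simp only [if_true, and_true] at h1
  have h2 : ∑ v, ∑ u, X.linkDegree {v} u = (d : ℝ) * (((d - 1 : ℕ) : ℝ) * X.topDegree ∅) := by
    have h3 := sum_linkDegree (X := X) ∅
    have h4 : ∀ v, X.linkDegree ∅ v = X.topDegree {v} := fun v => by simp [linkDegree]
    simp only [Finset.card_empty, Nat.sub_zero, h4] at h3
    simp only [sum_linkDegree, Finset.card_singleton, ← Finset.mul_sum, h3]
    ring
  -- The summand is symmetric and vanishes on the diagonal, so the ordered pairs `v < u` carry half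
  -- of it.
  have h5 : 2 * ∑ v, ∑ u, X.linkDegree {v} u * (if v < u then 1 else 0) =
      ∑ v, ∑ u, X.linkDegree {v} u := by
    rw [two_mul]
    nth_rewrite 2 [Finset.sum_comm]
    rw [← Finset.sum_add_distrib]
    refine Finset.sum_congr rfl fun v _ => ?_
    rw [← Finset.sum_add_distrib]
    refine Finset.sum_congr rfl fun u _ => ?_
    rcases lt_trichotomy v u with h | rfl | h
    · simp [h, h.not_gt]
    · simp [linkDegree]
    · have : X.linkDegree {v} u = X.linkDegree {u} v := by
        simp only [linkDegree, Finset.mem_singleton, h.ne, h.ne', if_false]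
        rw [Finset.pair_comm]
      simp [h, h.not_gt, this]
  rw [h5, h2] at h1
  have h6 : (0 : ℝ) < (d : ℝ) * (((d - 1 : ℕ) : ℝ) * X.topDegree ∅) := by
    rw [topDegree_empty]
    have h7 : (0 : ℝ) < Fintype.card (X.Face d) := Nat.cast_pos.2 card_top_pos
    have h8 : (0 : ℝ) < ((d - 1 : ℕ) : ℝ) := Nat.cast_pos.2 (by omega)
    have h9 : (0 : ℝ) < d := Nat.cast_pos.2 (by omega)
    positivity
  exact mul_right_cancel₀ h6.ne' (h1.trans (one_mul _).symm)

end PureComplex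

/-! ### Values as attained maxima -/

/-- Frees the value from the classical decidability instance in its definition. -/
theorem GenCSP.value_eq_iSup {V : Type} {G : WeightedGraph V V} {Sig : Type} (Ψ : GenCSP G Sig)
    [∀ f e, Decidable (Ψ.Satisfies f e)] : Ψ.value =
      ⨆ f : V → Sig, ∑ e ∈ G.edges, if Ψ.Satisfies f e then G.weight e else 0 := by
  unfold GenCSP.value
  congr!

theorem GenCSP.exists_value_eq {V : Type} [Finite V] {G : WeightedGraph V V} {Sig : Type}
    [Finite Sig] [Nonempty (V → Sig)] (Ψ : GenCSP G Sig) [∀ f e, Decidable (Ψ.Satisfies f e)] :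
    ∃ f : V → Sig, Ψ.value = ∑ e ∈ G.edges, if Ψ.Satisfies f e then G.weight e else 0 := by
  rw [Ψ.value_eq_iSup]
  obtain ⟨f, hf⟩ := exists_eq_ciSup_of_finite
    (f := fun f : V → Sig => ∑ e ∈ G.edges, if Ψ.Satisfies f e then G.weight e else 0)
  exact ⟨f, hf.symm⟩

theorem GenCSP.le_value {V : Type} [Finite V] {G : WeightedGraph V V} {Sig : Type} [Finite Sig]
    (Ψ : GenCSP G Sig) [∀ f e, Decidable (Ψ.Satisfies f e)] (f : V → Sig) :
    (∑ e ∈ G.edges, if Ψ.Satisfies f e then G.weight e else 0) ≤ Ψ.value := by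
  rw [Ψ.value_eq_iSup]
  exact le_ciSup (f := fun f : V → Sig =>
    ∑ e ∈ G.edges, if Ψ.Satisfies f e then G.weight e else 0) (Set.finite_range _).bddAbove f

namespace GenLabelCover

variable {L R : Type} {G : WeightedGraph L R} {SigL SigR : Type} (Φ : GenLabelCover G SigL SigR)
  [∀ x e, Decidable (x ∈ Φ.constraint e)]

theorem value_eq_iSup : Φ.value = ⨆ FH : (L → SigL) × (R → SigR),
    ∑ e ∈ G.edges, if (FH.1 e.1, FH.2 e.2) ∈ Φ.constraint e then G.weight e else 0 := by
  unfold GenLabelCover.value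
  congr!

variable [Finite L] [Finite R] [Finite SigL] [Finite SigR]

theorem exists_value_eq [Nonempty ((L → SigL) × (R → SigR))] :
    ∃ (F : L → SigL) (H : R → SigR), Φ.value =
      ∑ e ∈ G.edges, if (F e.1, H e.2) ∈ Φ.constraint e then G.weight e else 0 := by
  rw [Φ.value_eq_iSup]
  obtain ⟨FH, hf⟩ := exists_eq_ciSup_of_finite (f := fun FH : (L → SigL) × (R → SigR) =>
    ∑ e ∈ G.edges, if (FH.1 e.1, FH.2 e.2) ∈ Φ.constraint e then G.weight e else 0)
  exact ⟨FH.1, FH.2, hf.symm⟩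

theorem le_value (F : L → SigL) (H : R → SigR) :
    (∑ e ∈ G.edges, if (F e.1, H e.2) ∈ Φ.constraint e then G.weight e else 0) ≤ Φ.value := by
  rw [Φ.value_eq_iSup]
  exact le_ciSup (f := fun FH : (L → SigL) × (R → SigR) =>
    ∑ e ∈ G.edges, if (FH.1 e.1, FH.2 e.2) ∈ Φ.constraint e then G.weight e else 0)
    (Set.finite_range _).bddAbove (F, H)

end GenLabelCover

namespace PureComplex

variable {n d : ℕ} {X : PureComplex n d} {k s b : ℕ} {Sig : Type}

/-! ### The Label Cover instance of a 2-CSP -/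

open Classical in
/-- The Label Cover instance whose left labels are the labellings of `k`-faces that satisfy all
their edges, and whose projections are the restrictions. -/
noncomputable def labelCover (hk : 0 < k) (s : ℕ) (Ψ : GenCSP X.graph Sig) :
    GenLabelCover (X.inclusionGraph k s) (Fin k → Sig) (Fin s → Sig) where
  alphabet A := satisfyingLabels Ψ A
  -- The second branch is a filler that is never reached on an edge `(A, B)`, where `B ⊆ A`.
  proj e σ j := if h : ∃ i, X.vert e.1 i = X.vert e.2 j then σ.1 h.choose else σ.1 ⟨0, hk⟩

theorem labelCover_proj_apply (hk : 0 < k) (Ψ : GenCSP X.graph Sig) (e : X.Face k × X.Face s)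
    (σ : (labelCover hk s Ψ).alphabet e.1) {i : Fin k} {j : Fin s}
    (h : X.vert e.1 i = X.vert e.2 j) : (labelCover hk s Ψ).proj e σ j = σ.1 i := by
  have h1 : ∃ i, X.vert e.1 i = X.vert e.2 j := ⟨i, h⟩
  have h2 : h1.choose = i := (X.vert e.1).injective (h1.choose_spec.trans h.symm)
  change (if h : ∃ i, X.vert e.1 i = X.vert e.2 j then σ.1 h.choose else σ.1 ⟨0, hk⟩) = _
  rw [dif_pos h1, h2]

theorem restrictionProjections_labelCover (hk : 0 < k) (Ψ : GenCSP X.graph Sig) :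
    X.RestrictionProjections (labelCover hk s Ψ) :=
  fun e _ σ _ _ h => labelCover_proj_apply hk Ψ e σ h

theorem mem_inclusionGraph_edges {e : X.Face k × X.Face s} :
    e ∈ (X.inclusionGraph k s).edges ↔ e.2.1 ⊆ e.1.1 := by
  simp [inclusionGraph]

theorem mem_constraint_labelCover (hk : 0 < k) (Ψ : GenCSP X.graph Sig) {A : X.Face k}
    {B : X.Face s} (hBA : B.1 ⊆ A.1) {σ : Fin k → Sig} {τ : Fin s → Sig} :
    (σ, τ) ∈ (labelCover hk s Ψ).constraint (A, B) ↔ σ ∈ satisfyingLabels Ψ A ∧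
      ∀ i j, X.vert A i = X.vert B j → τ j = σ i := by
  constructor
  · rintro ⟨σ', h⟩
    obtain ⟨rfl, rfl⟩ := Prod.ext_iff.1 h
    exact ⟨σ'.2, fun i j hij => labelCover_proj_apply hk Ψ (A, B) σ' hij⟩
  · rintro ⟨h1, h2⟩
    refine ⟨⟨σ, h1⟩, Prod.ext rfl (funext fun j => ?_)⟩
    obtain ⟨i, hi⟩ := exists_vert_eq A (hBA (vert_mem B j))
    exact (labelCover_proj_apply hk Ψ (A, B) ⟨σ, h1⟩ hi).trans (h2 i j hi).symm

theorem describes_labelCover {enc : Sig ↪ (Fin b → Bool)} {Ψ : GenCSP X.graph Sig}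
    {code : CSPCode X b} (hcode : code.Describes enc Ψ) (hk : 0 < k) (hs : 0 < s) :
    (code.labelCover hk hs).Describes enc (labelCover hk s Ψ) where
  mem_edges e := by
    rw [mem_inclusionGraph_edges, CSPCode.labelCover, List.mem_flatMap]
    constructor
    · rintro ⟨D, _, hD⟩
      obtain ⟨A, _, hA⟩ := List.mem_flatMap.1 hD
      obtain ⟨B, hB, rfl⟩ := List.mem_map.1 hA
      exact (mem_subfaces hs A B).1 hB
    · intro h
      obtain ⟨D, hD⟩ := exists_top_of_mem_faces e.1.2.1
      exact ⟨D, hcode.mem_tops D, List.mem_flatMap.2 ⟨e.1, (mem_subfaces hk D e.1).2 hD,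
        List.mem_map.2 ⟨e.2, (mem_subfaces hs e.1 e.2).2 h, rfl⟩⟩⟩
  weight e he := by
    rw [CSPCode.length_edges_labelCover code hcode.tops_nodup hcode.mem_tops hk hs,
      CSPCode.count_edges_labelCover code hcode.tops_nodup hcode.mem_tops hk hs e.1 e.2
        (mem_inclusionGraph_edges.1 he)]
    change X.mu k e.1.1 / (k.choose s : ℝ) = _
    rw [mu, div_div]
    push_cast
    rw [mul_assoc]
  mem_left A := by
    obtain ⟨D, hD⟩ := exists_top_of_mem_faces A.2.1
    exact ⟨_, List.mem_flatMap.2 ⟨D, hcode.mem_tops D,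
      List.mem_map.2 ⟨A, (mem_subfaces hk D A).2 hD, rfl⟩⟩⟩
  left A C h := by
    obtain ⟨D, _, hD⟩ := List.mem_flatMap.1 h
    obtain ⟨A', _, hA'⟩ := List.mem_map.1 hD
    obtain ⟨rfl, rfl⟩ := Prod.ext_iff.1 hA'
    exact decides_all_faceChecks hcode.vertex hcode.edge A'
  proj := restrictionProjections_labelCover hk Ψ

theorem size_le_of_mem_left {code : CSPCode X b} (hk : 2 ≤ k) (hk0 : 0 < k) (hs : 0 < s)
    {A : X.Face k} {C : Circuit k b} (h : (A, C) ∈ (code.labelCover hk0 hs).left) :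
    C.size ≤ 3 * k ^ 2 * code.circuitSize := by
  obtain ⟨D, _, hD⟩ := List.mem_flatMap.1 h
  obtain ⟨A', _, hA'⟩ := List.mem_map.1 hD
  obtain ⟨rfl, rfl⟩ := Prod.ext_iff.1 hA'
  exact size_all_faceChecks_le hk (fun e he => Finset.le_sup (f := fun e : Fin n × Fin n =>
    (code.edgeCircuit e).size + (code.vertexCircuit e.1).size + (code.vertexCircuit e.2).size) he) _

theorem _root_.Circuit.Decides.exists_size_eq {a : ℕ} {enc : Sig ↪ (Fin b → Bool)}
    {S : Set (Fin a → Sig)} {C : Circuit a b} (hC : C.Decides enc S) :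
    ∃ C' : Circuit a b, C'.Decides enc S ∧ C'.size = circuitComplexity enc S :=
  Nat.sInf_mem (s := {m | ∃ C : Circuit a b, C.Decides enc S ∧ C.size = m}) ⟨_, C, hC, rfl⟩

theorem _root_.Circuit.Decides.circuitComplexity_le {a : ℕ} {enc : Sig ↪ (Fin b → Bool)}
    {S : Set (Fin a → Sig)} {C : Circuit a b} (hC : C.Decides enc S) :
    circuitComplexity enc S ≤ C.size :=
  Nat.sInf_le ⟨C, hC, rfl⟩

/-- The construction is run on optimal circuits instead of the given ones. The code serves only to
show that some circuit exists, so that the infimum is attained. -/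
theorem circuitComplexity_satisfyingLabels_le {enc : Sig ↪ (Fin b → Bool)}
    {Ψ : GenCSP X.graph Sig} {code : CSPCode X b} (hcode : code.Describes enc Ψ) (hk : 2 ≤ k)
    (A : X.Face k) : circuitComplexity enc (satisfyingLabels Ψ A) ≤
      3 * k ^ 2 * Ψ.decisionComplexity enc := by
  choose vc hvc using fun u => (hcode.vertex u).exists_size_eq
  have hec : ∀ e, ∃ C : Circuit 2 b, e ∈ X.graph.edges → C.Decides enc (Ψ.edgeSet e) ∧
      C.size = circuitComplexity enc (Ψ.edgeSet e) := fun e => by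
    by_cases he : e ∈ X.graph.edges
    · obtain ⟨C, hC⟩ := (hcode.edge e he).exists_size_eq
      exact ⟨C, fun _ => hC⟩
    · exact ⟨code.edgeCircuit e, fun h => absurd h he⟩
  choose ec hec using hec
  refine (decides_all_faceChecks (fun u => (hvc u).1)
    (fun e he => (hec e he).1) A).circuitComplexity_le.trans (size_all_faceChecks_le hk (fun e he => ?_) A)
  rw [(hec e he).2, (hvc _).2, (hvc _).2]
  exact Finset.le_sup (f := fun e : Fin n × Fin n => circuitComplexity enc (Ψ.edgeSet e) +
    circuitComplexity enc (Ψ.vertexSet e.1) + circuitComplexity enc (Ψ.vertexSet e.2)) he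

/-! ### Completeness -/

theorem sum_inclusionGraph (hs : 0 < s) (p : X.Face k → Finset (Fin n) → Prop)
    [∀ A B, Decidable (p A B)] :
    (∑ e ∈ (X.inclusionGraph k s).edges,
      if p e.1 e.2.1 then (X.inclusionGraph k s).weight e else 0) =
      ∑ A : X.Face k, ∑ B ∈ A.1.powersetCard s,
        X.mu k A.1 / (k.choose s : ℝ) * if p A B then 1 else 0 := by
  have h1 : ∀ e : X.Face k × X.Face s, e ∈ (X.inclusionGraph k s).edges ↔
      e ∈ (Finset.univ.filter fun e : X.Face k × X.Face s => e.2.1 ⊆ e.1.1) := fun e => by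
    rw [mem_inclusionGraph_edges]; simp
  rw [Finset.sum_congr (Finset.ext h1) fun e _ => rfl, Finset.sum_filter,
    Fintype.sum_prod_type]
  refine Finset.sum_congr rfl fun A _ => ?_
  rw [← sum_faces_subset hs A]
  refine Finset.sum_congr rfl fun B _ => ?_
  change (if B.1 ⊆ A.1 then (if p A B.1 then X.mu k A.1 / (k.choose s : ℝ) else 0) else 0) = _
  simp only [mul_ite, mul_one, mul_zero]

theorem sum_inclusionGraph_weight (hk : 0 < k) (hkd : k ≤ d) (hs : 0 < s) (hsk : s ≤ k) :
    ∑ e ∈ (X.inclusionGraph k s).edges, (X.inclusionGraph k s).weight e = 1 := by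
  have h1 := sum_inclusionGraph (X := X) (k := k) hs fun _ _ => True
  simp only [if_true, mul_one] at h1
  rw [h1, ← sum_mu (X := X) hk hkd]
  refine Finset.sum_congr rfl fun A _ => ?_
  have hA : A.1.card = k := A.2.2
  have h2 : (0 : ℝ) < k.choose s := Nat.cast_pos.2 (Nat.choose_pos hsk)
  rw [Finset.sum_const, Finset.card_powersetCard, hA, nsmul_eq_mul, mul_div_cancel₀ _ h2.ne']

theorem weight_inclusionGraph_nonneg (e : X.Face k × X.Face s) :
    0 ≤ (X.inclusionGraph k s).weight e :=
  div_nonneg (mu_nonneg _ _) (Nat.cast_nonneg _)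

theorem value_labelCover_eq_one [Finite Sig] (hk : 0 < k) (hkd : k ≤ d) (hs : 0 < s)
    (hsk : s ≤ k) (hd : 2 ≤ d) (Ψ : GenCSP X.graph Sig) (hΨ : Ψ.value = 1) :
    (labelCover hk s Ψ).value = 1 := by
  classical
  -- A supremum over an empty family is `0`, which differs from `1`.
  have hne : Nonempty (Fin n → Sig) := by
    by_contra h
    rw [not_nonempty_iff] at h
    rw [GenCSP.value, Real.iSup_of_isEmpty] at hΨ
    exact zero_ne_one hΨ
  obtain ⟨f, hf⟩ := Ψ.exists_value_eq
  -- All edge weights are positive and add up to one, so an assignment of value one misses no edge.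
  have hsat : ∀ e ∈ X.graph.edges, Ψ.Satisfies f e := by
    by_contra! h
    obtain ⟨e, he, hfe⟩ := h
    have h1 : ∑ e ∈ X.graph.edges, (if Ψ.Satisfies f e then X.graph.weight e else 0) <
        ∑ e ∈ X.graph.edges, X.graph.weight e := by
      refine Finset.sum_lt_sum (fun e _ => ?_) ⟨e, he, ?_⟩
      · split_ifs
        · exact le_rfl
        · exact mu_nonneg _ _
      · rw [if_neg hfe]
        have h2 := topDegree_pos (mem_graph_edges.1 he).2
        have h3 := card_top_pos (X := X)
        have h4 := Nat.choose_pos hd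
        change 0 < X.mu 2 {e.1, e.2}
        unfold mu
        positivity
    rw [sum_graph_weight hd, ← hf, hΨ] at h1
    exact lt_irrefl _ h1
  have hmem : ∀ e ∈ (X.inclusionGraph k s).edges,
      ((fun i => f (X.vert e.1 i)), fun j => f (X.vert e.2 j)) ∈
        (labelCover hk s Ψ).constraint e := fun e he => by
    refine (mem_constraint_labelCover hk Ψ (mem_inclusionGraph_edges.1 he)).2
      ⟨fun i j hij => hsat _ (vert_pair_mem_edges e.1 hij), fun i j h => ?_⟩
    simp only [h]
  have hle := (labelCover hk s Ψ).le_value (fun (A : X.Face k) i => f (X.vert A i))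
    fun B j => f (X.vert B j)
  rw [Finset.sum_congr rfl fun e he => if_pos (hmem e he),
    sum_inclusionGraph_weight hk hkd hs hsk] at hle
  refine le_antisymm ?_ hle
  have hne' : Nonempty ((X.Face k → Fin k → Sig) × (X.Face s → Fin s → Sig)) :=
    ⟨fun A i => f (X.vert A i), fun B j => f (X.vert B j)⟩
  obtain ⟨F, H, hFH⟩ := (labelCover hk s Ψ).exists_value_eq
  rw [hFH, ← sum_inclusionGraph_weight (X := X) hk hkd hs hsk]
  refine Finset.sum_le_sum fun e _ => ?_
  split_ifs
  · exact le_rfl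
  · exact weight_inclusionGraph_nonneg e

/-! ### Soundness -/

/-- A labelling that agrees on many vertices with satisfying labellings of many faces violates few
edges. -/
theorem sum_mu_few_violations_le {γ : ℝ} (hX : X.IsLocalSpectralExpander γ) (hγ : 0 ≤ γ)
    (hk : 3 ≤ k) (hkd : k ≤ d) (hγk : γ * k ≤ 1) (Ψ : GenCSP X.graph Sig) (f : Fin n → Sig)
    {δ : ℝ} (hδ0 : 0 < δ) (hδ1 : δ ≤ 1) [∀ e, Decidable (Ψ.Satisfies f e)]
    (hf : (∑ e ∈ X.graph.edges, if Ψ.Satisfies f e then X.graph.weight e else 0) ≤ 1 - 4 * δ)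
    (T : Finset (X.Face k))
    (hT : ∀ A ∈ T, ∑ v ∈ A.1, ∑ u ∈ A.1 \ {v}, violation Ψ f v u ≤
      δ ^ 2 * k * ((k - 1 : ℕ) : ℝ)) :
    ∑ A ∈ T, X.mu k A.1 ≤ 8 / (δ ^ 2 * ((k - 1 : ℕ) : ℝ)) := by
  have hd : 2 ≤ d := by omega
  set ω := ∑ e ∈ X.graph.edges, if ¬ Ψ.Satisfies f e then X.graph.weight e else 0 with hω
  have h1 : 4 * δ ≤ ω := by
    have h2 : (∑ e ∈ X.graph.edges, if Ψ.Satisfies f e then X.graph.weight e else 0) + ω = 1 := by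
      rw [hω, ← Finset.sum_add_distrib, ← sum_graph_weight (X := X) hd]
      refine Finset.sum_congr rfl fun e _ => ?_
      by_cases h : Ψ.Satisfies f e <;> simp [h]
    linarith
  have h3 := sum_edges_weight (X := X) hd fun e => ¬ Ψ.Satisfies f e
  have h4 : ∑ v, ∑ u, X.linkDegree {v} u * violation Ψ f v u =
      ω / 2 * ((d : ℝ) * (((d - 1 : ℕ) : ℝ) * X.topDegree ∅)) := by
    have h5 : ∀ v u, violation Ψ f v u = if v < u ∧ ¬ Ψ.Satisfies f (v, u) then 1 else 0 :=
      fun v u => by unfold violation; congr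
    simp only [h5]
    linarith
  have h6 := sum_pairs_sq_sub_mean_le hX hγ hk hkd hγk (violation Ψ f) (violation_nonneg Ψ f)
    (violation_le_one Ψ f) _ h4
  have hk1 : (0 : ℝ) < ((k - 1 : ℕ) : ℝ) := Nat.cast_pos.2 (by omega)
  have hk0 : (0 : ℝ) < k := Nat.cast_pos.2 (by omega)
  set W : ℝ := (k : ℝ) * ((k - 1 : ℕ) : ℝ) with hW
  have hW0 : 0 < W := mul_pos hk0 hk1
  have h7 : ∀ A ∈ T, (X.topDegree A.1 : ℝ) * (δ * W) ^ 2 ≤ (X.topDegree A.1 : ℝ) *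
      (∑ v ∈ A.1, ∑ u ∈ A.1 \ {v}, violation Ψ f v u - W * (ω / 2)) ^ 2 := fun A hA => by
    refine mul_le_mul_of_nonneg_left ?_ (Nat.cast_nonneg _)
    have h8 := hT A hA
    rw [mul_assoc, ← hW] at h8
    -- The mean is `W ω/2 ≥ 2δ W` and the faces of `T` have at most `δ² W ≤ δ W` violations, so they
    -- deviate by at least `δ W`; Chebyshev's inequality follows.
    have h9 : δ * W ≤ W * (ω / 2) - ∑ v ∈ A.1, ∑ u ∈ A.1 \ {v}, violation Ψ f v u := by
      have h10 : W * (4 * δ) ≤ W * ω := mul_le_mul_of_nonneg_left h1 hW0.le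
      have h11 : δ ^ 2 * W ≤ δ * W := mul_le_mul_of_nonneg_right (by nlinarith) hW0.le
      linarith
    rw [← neg_sq (_ - _), neg_sub]
    exact pow_le_pow_left₀ (by positivity) h9 2
  have h12 : (∑ A ∈ T, (X.topDegree A.1 : ℝ)) * (δ * W) ^ 2 ≤
      8 * (k : ℝ) ^ 2 * ((k - 1 : ℕ) : ℝ) * ((d.choose k : ℝ) * X.topDegree ∅) := by
    rw [Finset.sum_mul]
    refine (Finset.sum_le_sum h7).trans (le_trans ?_ h6)
    exact Finset.sum_le_sum_of_subset_of_nonneg (Finset.subset_univ _) fun A _ _ =>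
      mul_nonneg (Nat.cast_nonneg _) (sq_nonneg _)
  rw [topDegree_empty] at h12
  have h13 : (0 : ℝ) < Fintype.card (X.Face d) := Nat.cast_pos.2 card_top_pos
  have h14 : (0 : ℝ) < d.choose k := Nat.cast_pos.2 (Nat.choose_pos hkd)
  simp only [mu, ← Finset.sum_div]
  rw [div_le_div_iff₀ (by positivity) (by positivity)]
  have h15 : 0 < (k : ℝ) ^ 2 * ((k - 1 : ℕ) : ℝ) := by positivity
  refine le_of_mul_le_mul_right ?_ h15
  calc _ = (∑ A ∈ T, (X.topDegree A.1 : ℝ)) * (δ * W) ^ 2 := by rw [hW]; ring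
    _ ≤ _ := h12
    _ = _ := by ring

theorem lt_value_of_le_value_labelCover {γ : ℝ} (hX : X.IsLocalSpectralExpander γ) (hγ : 0 ≤ γ)
    (hk : 3 ≤ k) (hkd : k < d) (hγk : γ * k ≤ 1) (hs : 0 < s) (hsk : s ≤ k) [Finite Sig]
    (Ψ : GenCSP X.graph Sig) {δ η : ℝ} (hδ0 : 0 < δ) (hδ1 : δ ≤ 1 / 4)
    (hη : 2 / (k : ℝ) + 8 / (δ ^ 2 * ((k - 1 : ℕ) : ℝ)) < η)
    (hDP : X.DPTestSound k s (δ ^ 2) η) (hk0 : 0 < k) (hΦ : δ ≤ (labelCover hk0 s Ψ).value) :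
    1 - 4 * δ < Ψ.value := by
  classical
  have hne : Nonempty ((X.Face k → Fin k → Sig) × (X.Face s → Fin s → Sig)) := by
    by_contra h
    rw [not_nonempty_iff] at h
    rw [GenLabelCover.value, Real.iSup_of_isEmpty] at hΦ
    exact absurd hΦ (not_le.2 hδ0)
  -- The supremum is attained, since nonemptiness is known and all types are finite.
  obtain ⟨F, H, hFH⟩ := (labelCover hk0 s Ψ).exists_value_eq
  obtain ⟨D⟩ := Fintype.card_pos_iff.1 (card_top_pos (X := X))
  have hSig : Nonempty Sig := by
    obtain ⟨A, hA⟩ := Finset.exists_subset_card_eq (n := k) (s := D.1) (by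
      have : D.1.card = d := D.2.2
      omega)
    exact ⟨F (mkFace A ⟨X.mem_faces_of_subset D.2.1 hA.1
      (Finset.card_pos.1 (by omega)), hA.2⟩) ⟨0, hk0⟩⟩
  -- Faces without a satisfying label are given symbols of their own.
  let F' : X.Face k → Fin k → Sig ⊕ X.Face k := fun A i =>
    if F A ∈ satisfyingLabels Ψ A then .inl (F A i) else .inr A
  -- The test draws plain sets `B`, whereas `H` lives on faces; hence the proof `hB` inside the
  -- predicate.
  let G : X.Face k → Finset (Fin n) → Prop := fun A B => ∃ hB : B ∈ X.faces ∧ B.card = s,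
    B ⊆ A.1 ∧ (F A, H (mkFace B hB)) ∈ (labelCover hk0 s Ψ).constraint (A, mkFace B hB)
  have hG : ∀ A A' B, G A B → G A' B → X.Agree F' B A A' := by
    rintro A A' B ⟨hB, hBA, h1⟩ ⟨_, hBA', h2⟩ i i' hi hii'
    obtain ⟨h3, h4⟩ := (mem_constraint_labelCover hk0 Ψ (B := mkFace B hB) hBA).1 h1
    obtain ⟨h5, h6⟩ := (mem_constraint_labelCover hk0 Ψ (B := mkFace B hB) hBA').1 h2
    obtain ⟨j, hj⟩ := exists_vert_eq (mkFace B hB) hi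
    simp only [F', h3, h5, if_true]
    rw [← h4 i j hj.symm, ← h6 i' j (hii'.symm.trans hj.symm)]
  have hpass : δ ^ 2 ≤ X.passProb s F' := by
    refine le_trans ?_ (sq_le_passProb hk0 hsk F' G hG)
    refine pow_le_pow_left₀ hδ0.le (hΦ.trans ?_) 2
    rw [hFH, ← sum_inclusionGraph hs G]
    refine Finset.sum_le_sum fun e he => ?_
    have h1 := mem_inclusionGraph_edges.1 he
    by_cases h2 : (F e.1, H e.2) ∈ (labelCover hk0 s Ψ).constraint e
    · have h3 : G e.1 e.2.1 := ⟨e.2.2, h1, h2⟩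
      rw [if_pos h2, if_pos h3]
    · rw [if_neg h2]
      split_ifs
      · exact weight_inclusionGraph_nonneg e
      · exact le_rfl
  obtain ⟨f, hf⟩ := hDP (Sig ⊕ X.Face k) F' hpass
  -- Private symbols in `f` are replaced arbitrarily. Wherever `f` agrees with a label `inl σ`, so
  -- does `f'` with `σ`.
  let f' : Fin n → Sig := fun v => (f v).elim (fun a => a) fun _ => Classical.arbitrary Sig
  refine lt_of_lt_of_le ?_ (Ψ.le_value f')
  by_contra! hval
  -- The same instance as in `agreementProb`, so that `close` unfolds to its condition.
  let _ : DecidableEq (Sig ⊕ X.Face k) := fun a b => Classical.propDecidable (a = b)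
  let close : X.Face k → Prop := fun A =>
    (hammingDist (F' A) (fun i => f (X.vert A i)) : ℝ) / k ≤ δ ^ 2
  have hkr : (0 : ℝ) < k := Nat.cast_pos.2 hk0
  have hbad := sum_mu_close_const_le hk0 hkd f Sum.inr Sum.inr_injective
    (Finset.univ.filter fun A : X.Face k => close A ∧ F A ∉ satisfyingLabels Ψ A) (fun A hA => by
      obtain ⟨h1, h2⟩ := (Finset.mem_filter.1 hA).2
      have h3 : F' A = fun _ => Sum.inr A := by
        funext i; simp only [F', h2, if_false]
      simp only [close, h3] at h1
      exact h1.trans (by nlinarith))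
  have hgood := sum_mu_few_violations_le hX hγ hk hkd.le hγk Ψ f' hδ0 (by linarith) hval
    (Finset.univ.filter fun A : X.Face k => close A ∧ F A ∈ satisfyingLabels Ψ A) (fun A hA => by
      obtain ⟨h1, h2⟩ := (Finset.mem_filter.1 hA).2
      have h3 : F' A = fun i => Sum.inl (F A i) := by
        funext i; simp only [F', h2, if_true]
      simp only [close, h3] at h1
      rw [div_le_iff₀ hkr] at h1
      refine (sum_violation_le Ψ f' A h2
        (Finset.univ.filter fun i => Sum.inl (F A i) ≠ f (X.vert A i)) fun i hi => ?_).trans ?_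
      · have h4 : Sum.inl (F A i) = f (X.vert A i) := by simpa using hi
        simp only [f', ← h4, Sum.elim_inl]
      · exact mul_le_mul_of_nonneg_right h1 (Nat.cast_nonneg _))
  -- The close faces split into those with a private symbol and those with an allowed label; `hbad`
  -- and `hgood` bound the two masses, against `hη`.
  have hsum : X.agreementProb F' f (δ ^ 2) =
      ∑ A ∈ Finset.univ.filter (fun A : X.Face k => close A ∧ F A ∉ satisfyingLabels Ψ A),
        X.mu k A.1 +
      ∑ A ∈ Finset.univ.filter (fun A : X.Face k => close A ∧ F A ∈ satisfyingLabels Ψ A),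
        X.mu k A.1 := by
    rw [Finset.sum_filter, Finset.sum_filter, ← Finset.sum_add_distrib, agreementProb]
    refine Finset.sum_congr rfl fun A _ => ?_
    have h1 : ((hammingDist (F' A) (fun i => f (X.vert A i)) : ℝ) / k ≤ δ ^ 2) ↔ close A :=
      Iff.rfl
    refine (if_congr h1 rfl rfl).trans ?_
    by_cases h2 : close A <;> by_cases h3 : F A ∈ satisfyingLabels Ψ A <;> simp [h2, h3]
  linarith

end PureComplex

/-- `K` is absolute; `c` and `r` are the constants of the polynomial `poly(t) = c * t ^ r` in the
definition of soundness of the direct product test; `s = √k`. The last four conjuncts are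
completeness, soundness, and soundness in contrapositive form. -/
theorem lemma7p2 :
    ∃ K : ℕ, ∀ (c : ℝ) (r : ℕ), 0 < c → ∀ δ : ℝ, 0 < δ →
      ∃ k₀ : ℕ, ∀ k s : ℕ, k = s ^ 2 → k₀ ≤ k →
        ∃ γ : ℝ, 0 < γ ∧ ∃ (P : Prog) (p : Polynomial ℕ),
          ∀ (n d : ℕ) (X : PureComplex n d), k < d →
            X.IsLocalSpectralExpander γ →
            X.DPTestSound k s (δ ^ 2) (c * (δ ^ 2) ^ r) →
            ∀ (Sig : Type) (b : ℕ) (enc : Sig ↪ (Fin b → Bool)) (Ψ : GenCSP X.graph Sig)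
              (code : CSPCode X b), code.Describes enc Ψ →
              P.cost code.toDat ≤ p.eval code.toDat.size ∧
              ∃ (Φ : GenLabelCover (X.inclusionGraph k s) (Fin k → Sig) (Fin s → Sig))
                (out : LabelCoverCode X k s b),
                P.eval code.toDat = out.toDat ∧ out.Describes enc Φ ∧
                X.RestrictionProjections Φ ∧
                (∀ A : X.Face k, circuitComplexity enc (Φ.alphabet A) ≤
                  K * k ^ 2 * Ψ.decisionComplexity enc) ∧
                (∀ A C, (A, C) ∈ out.left → C.size ≤ K * k ^ 2 * code.circuitSize) ∧
                (Ψ.value = 1 → Φ.value = 1) ∧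
                (δ ≤ Φ.value → 1 - 4 * δ ≤ Ψ.value) ∧
                (Ψ.value ≤ 1 - 4 * δ → Φ.value ≤ δ) := by
  -- The constant `3` is that of `size_all_faceChecks_le`.
  refine ⟨3, fun c r hc δ hδ => ?_⟩
  set η := c * (δ ^ 2) ^ r with hη
  have hη0 : 0 < η := by positivity
  -- Since `k ≤ 2(k-1)`, the two exceptional masses sum to at most `(2 + 16/δ²)/k`, which has to be
  -- below `η`.
  obtain ⟨N, hN⟩ := exists_nat_gt ((2 + 16 / δ ^ 2) / η)
  refine ⟨max N 4, fun k s hks hk₀ => ?_⟩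
  have hk4 : 4 ≤ k := (le_max_right _ _).trans hk₀
  have hk0 : 0 < k := by omega
  have hs : 0 < s := by
    rcases Nat.eq_zero_or_pos s with rfl | h
    · simp at hks; omega
    · exact h
  have hsk : s ≤ k := hks ▸ Nat.le_self_pow two_ne_zero s
  have hkr : (0 : ℝ) < k := Nat.cast_pos.2 hk0
  have hlarge : 2 / (k : ℝ) + 8 / (δ ^ 2 * ((k - 1 : ℕ) : ℝ)) < η := by
    have h1 : (2 + 16 / δ ^ 2) / η < k :=
      hN.trans_le (Nat.cast_le.2 ((le_max_left _ _).trans hk₀))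
    rw [div_lt_iff₀ hη0] at h1
    have h2 : (k : ℝ) ≤ 2 * ((k - 1 : ℕ) : ℝ) := by
      have : k ≤ 2 * (k - 1) := by omega
      exact_mod_cast this
    have h3 : 8 / (δ ^ 2 * ((k - 1 : ℕ) : ℝ)) ≤ 16 / δ ^ 2 / k := by
      rw [div_div, div_le_div_iff₀ (by nlinarith [sq_pos_of_pos hδ]) (by positivity)]
      nlinarith [mul_le_mul_of_nonneg_left h2 (sq_nonneg δ)]
    have h4 : 2 / (k : ℝ) + 16 / δ ^ 2 / k < η := by
      rw [← add_div, div_lt_iff₀ hkr]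
      linarith
    linarith
  obtain ⟨P, p, hP⟩ := PolyTime.labelCover k s
  -- `γ = 1/k` is the largest value with `γ k ≤ 1`, as the sampling lemmas require.
  refine ⟨1 / k, by positivity, P, p, fun n d X hkd hX hDP Sig b enc Ψ code hcode =>
    ⟨(hP _).2, PureComplex.labelCover hk0 s Ψ, code.labelCover hk0 hs, ?_,
      PureComplex.describes_labelCover hcode hk0 hs,
      PureComplex.restrictionProjections_labelCover hk0 Ψ,
      fun A => PureComplex.circuitComplexity_satisfyingLabels_le hcode (by omega) A,
      fun A C h => PureComplex.size_le_of_mem_left (by omega) hk0 hs h, ?_⟩⟩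
  · rw [(hP _).1, CSPCode.labelCover_toDat code hcode.mem_edges]
  have hfin : Finite Sig := Finite.of_injective enc enc.injective
  refine ⟨PureComplex.value_labelCover_eq_one hk0 hkd.le hs hsk (by omega) Ψ, ?_⟩
  have hsound : δ ≤ 1 / 4 → δ ≤ (PureComplex.labelCover hk0 s Ψ).value →
      1 - 4 * δ < Ψ.value := fun hδ4 =>
    PureComplex.lt_value_of_le_value_labelCover hX (by positivity) (by omega) hkd
      (by rw [one_div, inv_mul_cancel₀ hkr.ne']) hs hsk Ψ hδ hδ4 hlarge hDP hk0
  have hval : 0 ≤ Ψ.value := by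
    refine Real.iSup_nonneg fun f => Finset.sum_nonneg fun e _ => ?_
    split_ifs
    · exact PureComplex.mu_nonneg _ _
    · exact le_rfl
  -- The strict inequality in `hsound` yields both forms of soundness. For `δ > 1/4`, `1 - 4δ` is
  -- negative, so the first form is trivial and the hypothesis of the second is impossible.
  rcases le_or_gt δ (1 / 4) with hδ4 | hδ4
  · exact ⟨fun h => (hsound hδ4 h).le, fun h => le_of_not_gt fun h' =>
      absurd (hsound hδ4 h'.le) (not_lt.2 h)⟩
  · exact ⟨fun _ => by linarith, fun h => by linarith⟩
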